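/- Fix $n\ge 1$, a set $\mathcal X$, design points $x_1,\dots,x_n\in\mathcal X$, and write $\|g\|_n^2=\frac1n\sum_{i=1}^n g(x_i)^2$. Let $\mathcal F$ be a convex class of functions $\mathcal X\to\mathbb R$ that is closed in $\|\cdot\|_n$ (i.e. $\{(f(x_1),\dots,f(x_n)):f\in\mathcal F\}$ is closed in $\mathbb R^n$) and whose diameter satisfies $d\le \operatorname{diam}_n(\mathcal F)\le D$ for constants $d,D>0$. We observe $Y_i=f^*(x_i)+\xi_i$, $i\le n$, with $f^*\in\mathcal F$, where the noise $\xi$ is either $N(0,I_{n\times n})$ or any random vector in $\mathbb R^n$ with the Lipschitz concentration property with constant $c_L>0$: for every $1$-Lipschitz $G:\mathbb R^n\to\mathbb R$, $G(\xi)$ is integrable and $\Pr(|G(\xi)-\mathbb E\,G(\xi)|\ge t)\le 2\exp(-c_Lt^2)$ for all $t\ge 0$. Let $\widehat f_n$ be a least squares estimator, that is, a selection $\widehat f_n\in\operatorname{argmin}_{f\in\mathcal F}\sum_{i}(Y_i-f(x_i))^2$, and for $\delta\ge 0$ let $$\mathcal O_\delta=\Big\{f\in\mathcal F:\ \tfrac1n\sum_{i}(Y_i-f(x_i))^2\le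 \tfrac1n\sum_{i}(Y_i-\widehat f_n(x_i))^2+\delta\Big\}.$$ Let $\mathcal N(\epsilon)$ be the minimal cardinality of a set $S\subseteq\mathcal F$ such that every $f\in\mathcal F$ has some $g\in S$ with $\|f-g\|_n\le\epsilon$. Let $$\mathcal V=\sup_{f^*\in\mathcal F}\mathbb E_\xi\|\widehat f_n-\mathbb E_\xi\widehat f_n\|_n^2,\qquad \mathcal M=\inf_{\bar f}\ \sup_{f^*\in\mathcal F}\ \mathbb E_{\xi\sim N(0,I)}\|\bar f(f^*(x_1)+\xi_1,\dots,f^*(x_n)+\xi_n)-f^*\|_n^2,$$ the worst-case variance of $\widehat f_n$, and the minimax rate of $\mathcal F$ under standard Gaussian noise; the infimum is over all measurable estimators $\bar f$. Then there is a constant $c>0$ depending only on $c_L$ (an absolute constant for Gaussian noise), and for all constants $a,b,K>0$ there is a constant $C>0$ depending only on $a,b,d,D,K,c_L$ (in particular not on $n$, $\mathcal X$, the design, $\mathcal F$ or the law of the noise), such that the following holds. (1) Let $\epsilon_*>0$ be a solution of $\log\mathcal N(\epsilon_*)\asymp n\epsilon_*^2$, in the sense that $a\,n\epsilon_*^2\le\log\mathcal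 N(\epsilon_*)\le b\,n\epsilon_*^2$. Then for every $f^*\in\mathcal F$ and every $0\le\delta_n\le K\epsilon_*^2$, with probability at least $1-2\exp(-cn\epsilon_*^2)$, $$\sup_{f\in\mathcal O_{\delta_n}}\|f-\mathbb E_\xi\widehat f_n\|_n^2\le C\epsilon_*^2;$$ moreover $\mathcal V\le C\epsilon_*^2$. (2) $\mathcal V\le C\,\mathcal M$. The variables $\widehat f_n(x_i)$ are integrable, so that the expectation $\mathbb E_\xi\widehat f_n$ exists at the design points. -/

import Mathlib

open MeasureTheory ProbabilityTheory
open scoped ENNReal NNReal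

noncomputable section

namespace FixedDesign

/-- The noise vector and the vector of observations live in `ℝⁿ` with the Euclidean norm. -/
abbrev Vec (n : ℕ) : Type := EuclideanSpace ℝ (Fin n)

/-- The integral of `g` against the uniform measure on the design points `x₁, …, xₙ`. -/
def empMean {X : Type*} {n : ℕ} (x : Fin n → X) (g : X → ℝ) : ℝ :=
  (1 / (n : ℝ)) * ∑ i, g (x i)

/-- The vector `(f (x₁), …, f (xₙ)) / √n`: its Euclidean norm is the empirical `L²` norm of `f`,
see `norm_empVec_sq`. -/
def empVec {X : Type*} {n : ℕ} (x : Fin n → X) (f : X → ℝ) : Vec n :=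
  WithLp.toLp 2 fun i => f (x i) / Real.sqrt n

theorem norm_empVec_sq {X : Type*} {n : ℕ} (x : Fin n → X) (f : X → ℝ) :
    ‖empVec x f‖ ^ 2 = empMean x fun p => f p ^ 2 := by
  rw [EuclideanSpace.norm_sq_eq, empMean, Finset.mul_sum]
  refine Finset.sum_congr rfl fun i _ => ?_
  simp only [empVec, Real.norm_eq_abs, sq_abs, div_pow]
  rw [Real.sq_sqrt (Nat.cast_nonneg n)]
  ring

theorem dist_empVec_sq {X : Type*} {n : ℕ} (x : Fin n → X) (f g : X → ℝ) :
    dist (empVec x f) (empVec x g) ^ 2 = empMean x fun p => (f p - g p) ^ 2 := by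
  rw [dist_eq_norm, ← norm_empVec_sq x fun p => f p - g p]
  congr 2
  ext i
  simp [empVec, sub_div]

/-- The class `F`, seen in the `L²` space of the uniform measure on the design points. Distances,
diameter, closedness and covering numbers of `F` in the empirical `L²` (semi)norm are those of this
subset of `ℝⁿ`. -/
def empClass {X : Type*} {n : ℕ} (x : Fin n → X) (F : Set (X → ℝ)) : Set (Vec n) :=
  empVec x '' F

/-- `F` is convex, and closed in the empirical `L²` norm. -/
def IsConvexClosedClass {X : Type*} {n : ℕ} (x : Fin n → X) (F : Set (X → ℝ)) : Prop :=
  Convex ℝ F ∧ IsClosed (empClass x F)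

/-- The empirical `L²` diameter of `F` lies between `d` and `D`. -/
def HasDiamBetween {X : Type*} {n : ℕ} (x : Fin n → X) (F : Set (X → ℝ)) (d D : ℝ) : Prop :=
  ENNReal.ofReal d ≤ Metric.ediam (empClass x F) ∧
    Metric.ediam (empClass x F) ≤ ENNReal.ofReal D

/-- `ε > 0` solves the balance equation `log N(ε, F) ≍ n ε²`, with the implied constants `a`, `b`;
here `N(ε, F)` is the (finite) `ε`-covering number of `F` in the empirical `L²` norm. -/
def IsBalanced {X : Type*} {n : ℕ} (x : Fin n → X) (F : Set (X → ℝ)) (a b ε : ℝ) : Prop :=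
  0 < ε ∧ ∃ N : ℕ, Metric.coveringNumber ε.toNNReal (empClass x F) = (N : ℕ∞) ∧
    a * (n * ε ^ 2) ≤ Real.log N ∧ Real.log N ≤ b * (n * ε ^ 2)

/-- The observations `Yᵢ = f* (xᵢ) + ξᵢ`. -/
def obs {X : Type*} {n : ℕ} (x : Fin n → X) (fstar : X → ℝ) (ξ : Vec n) : Vec n :=
  WithLp.toLp 2 fun i => fstar (x i) + ξ i

/-- The empirical square loss of `f` on the observations `Y`. -/
def empLoss {X : Type*} {n : ℕ} (x : Fin n → X) (Y : Vec n) (f : X → ℝ) : ℝ :=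
  (1 / (n : ℝ)) * ∑ i, (Y i - f (x i)) ^ 2

/-- `fhat` is a least squares estimator over `F`: it selects a minimizer of the empirical square
loss for every vector of observations. -/
def IsLSE {X : Type*} {n : ℕ} (x : Fin n → X) (F : Set (X → ℝ)) (fhat : Vec n → X → ℝ) : Prop :=
  ∀ Y, fhat Y ∈ F ∧ ∀ g ∈ F, empLoss x Y (fhat Y) ≤ empLoss x Y g

/-- The set of `δ`-approximate minimizers of the empirical square loss. -/
def almostMinimizers {X : Type*} {n : ℕ} (x : Fin n → X) (F : Set (X → ℝ))
    (fhat : Vec n → X → ℝ) (Y : Vec n) (δ : ℝ) : Set (X → ℝ) :=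
  {f | f ∈ F ∧ empLoss x Y f ≤ empLoss x Y (fhat Y) + δ}

/-- The Lipschitz concentration property with constant `cL` of a noise distribution. -/
def LipschitzConcentration {n : ℕ} (cL : ℝ) (μ : Measure (Vec n)) : Prop :=
  ∀ G : Vec n → ℝ, LipschitzWith 1 G → Integrable G μ ∧
    ∀ t : ℝ, 0 ≤ t → μ {ξ | t ≤ |G ξ - ∫ ζ, G ζ ∂μ|} ≤ ENNReal.ofReal (2 * Real.exp (-cL * t ^ 2))

/-- The pointwise expectation over the noise of the estimator `est`, when the regression function
is `fstar`. -/
def expectedEst {X : Type*} {n : ℕ} (x : Fin n → X) (μ : Measure (Vec n)) (est : Vec n → X → ℝ)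
    (fstar : X → ℝ) : X → ℝ :=
  fun p => ∫ ξ, est (obs x fstar ξ) p ∂μ

/-- The variance of `est` at the regression function `fstar`. -/
def variance {X : Type*} {n : ℕ} (x : Fin n → X) (μ : Measure (Vec n)) (est : Vec n → X → ℝ)
    (fstar : X → ℝ) : ℝ≥0∞ :=
  ∫⁻ ξ, ENNReal.ofReal
    (empMean x fun p => (est (obs x fstar ξ) p - expectedEst x μ est fstar p) ^ 2) ∂μ

/-- The worst-case variance of `est` over the regression functions in `F`. -/
def maxVariance {X : Type*} {n : ℕ} (x : Fin n → X) (μ : Measure (Vec n)) (F : Set (X → ℝ))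
    (est : Vec n → X → ℝ) : ℝ≥0∞ :=
  ⨆ fstar ∈ F, variance x μ est fstar

/-- The risk of the estimator `est` over the class `F`. -/
def risk {X : Type*} {n : ℕ} (x : Fin n → X) (μ : Measure (Vec n)) (F : Set (X → ℝ))
    (est : Vec n → X → ℝ) : ℝ≥0∞ :=
  ⨆ fstar ∈ F, ∫⁻ ξ, ENNReal.ofReal
    (empMean x fun p => (fstar p - est (obs x fstar ξ) p) ^ 2) ∂μ

/-- The minimax rate of `F` under standard Gaussian noise: the infimum of the risk over all
measurable estimators. -/
def minimaxRate {X : Type*} {n : ℕ} (x : Fin n → X) (F : Set (X → ℝ)) : ℝ≥0∞ :=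
  ⨅ (est : Vec n → X → ℝ) (_ : Measurable est), risk x (stdGaussian (Vec n)) F est

end FixedDesign

end

/-! After division by `√n`, least squares is the metric projection of `f* + ξ/√n` onto a convex set
`K`. Projections are nonexpansive, so the estimator `Z` is `1/√n`-Lipschitz in the noise, and each
`‖Z - g‖` deviates from its mean by `t` with probability at most `2 exp(-c n t²)`. Read backwards
(`integral_norm_sub_le_of_lt_measure`): if `Z` falls within `ρ` of `g` with probability above `2
exp(-c n t²)`, then `E‖Z - g‖ ≤ ρ + t`. It thus suffices to find one ball of not too small
probability; its center may depend on `f*` and need not be near it.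

For (1), pigeonhole over an `ε`-cover gives a ball of probability at least `1/N`, and `log N ≲ nε²`
allows `t ≍ ε`. The mean of `Z` is then also within `O(ε)` of the center, and convexity of `K` keeps
almost minimizers within `√δ` of `Z`.

For (2), global covers are replaced by local ones. An estimator of risk `R` must distinguish the
points of a packing, so by Cameron–Martin a local packing at scale `r ≍ √R` has at most `2 exp(n
r²)` points (`card_le_of_separated`). Homotheties of `K` extend this count to every scale `s ≥ r`
(`exists_local_cover`). Pigeonhole then improves any center whose mean distance far exceeds `r`, so
a near-optimal center has mean distance `O(r)` (`exists_integral_norm_sub_lt_of_risk`). The residual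
variance `1/n` is absorbed by the two-point bound `R ≳ 1/n`, which uses the lower bound on the
diameter. -/

noncomputable section

namespace FixedDesign

open scoped RealInnerProductSpace

/-! ### Shifts of the standard Gaussian measure -/

section Gaussian

variable {n : ℕ}

/-- Complex exponents are allowed so that `z = u + i t` computes the characteristic function of the
measure tilted by `u`. -/
theorem integral_cexp_stdGaussian (z : Fin n → ℂ) :
    ∫ x, Complex.exp (∑ i, z i * (x i : ℂ)) ∂(stdGaussian (Vec n))
      = Complex.exp (∑ i, z i ^ 2 / 2) := by
  rw [← map_pi_eq_stdGaussian, integral_map (by fun_prop) (by fun_prop)]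
  simp_rw [Complex.exp_sum]
  rw [integral_fintype_prod_eq_prod (f := fun i (y : ℝ) => Complex.exp (z i * (y : ℂ)))]
  refine Finset.prod_congr rfl fun i _ => ?_
  simpa [complexMGF] using complexMGF_id_gaussianReal (μ := 0) (v := 1) (z i)

theorem integrable_exp_inner_stdGaussian (u : Vec n) :
    Integrable (fun x => Real.exp (⟪u, x⟫ - ‖u‖ ^ 2 / 2)) (stdGaussian (Vec n)) := by
  have h : Integrable (fun x : Vec n => Real.exp (∑ i, u i * x i)) (stdGaussian (Vec n)) := by
    rw [← map_pi_eq_stdGaussian, integrable_map_measure (by fun_prop) (by fun_prop)]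
    simp only [Function.comp_def, Real.exp_sum]
    exact Integrable.fintype_prod fun i => by
      simpa using integrable_exp_mul_gaussianReal (μ := 0) (v := 1) (u i)
  refine (h.mul_const (Real.exp (-(‖u‖ ^ 2 / 2)))).congr (ae_of_all _ fun x => ?_)
  simp only [← Real.exp_add, PiLp.inner_apply, sub_eq_add_neg]
  simp [mul_comm]

/-- The Cameron–Martin formula for the standard Gaussian measure. -/
theorem map_add_const_stdGaussian (u : Vec n) :
    (stdGaussian (Vec n)).map (· + u) = (stdGaussian (Vec n)).withDensity
      fun x => ENNReal.ofReal (Real.exp (⟪u, x⟫ - ‖u‖ ^ 2 / 2)) := by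
  have hint := integrable_exp_inner_stdGaussian u
  have : IsFiniteMeasure ((stdGaussian (Vec n)).withDensity
      fun x => ENNReal.ofReal (Real.exp (⟪u, x⟫ - ‖u‖ ^ 2 / 2))) :=
    isFiniteMeasure_withDensity_ofReal hint.2
  have : IsProbabilityMeasure ((stdGaussian (Vec n)).map (· + u)) :=
    Measure.isProbabilityMeasure_map (by fun_prop)
  refine Measure.ext_of_charFun (funext fun t => ?_)
  rw [charFun_map_add_const, charFun_stdGaussian, charFun_apply,
    integral_withDensity_eq_integral_toReal_smul (by fun_prop) (by simp)]
  have h := integral_cexp_stdGaussian fun i => (u i : ℂ) + t i * Complex.I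
  have e : ∀ x : Vec n, (ENNReal.ofReal (Real.exp (⟪u, x⟫ - ‖u‖ ^ 2 / 2))).toReal •
      Complex.exp (⟪x, t⟫ * Complex.I) = Complex.exp (-(‖u‖ ^ 2 / 2 : ℝ)) *
        Complex.exp (∑ i, ((u i : ℂ) + t i * Complex.I) * (x i : ℂ)) := by
    intro x
    rw [ENNReal.toReal_ofReal (Real.exp_pos _).le, Complex.real_smul, Complex.ofReal_exp,
      ← Complex.exp_add, ← Complex.exp_add]
    congr 1
    simp only [PiLp.inner_apply, add_mul, Finset.sum_add_distrib]
    push_cast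
    simp only [RCLike.inner_apply, conj_trivial, Complex.ofReal_mul, Finset.sum_mul]
    rw [sub_add_eq_add_sub, sub_eq_add_neg, add_comm]
    congr 2
    · exact Finset.sum_congr rfl fun i _ => by ring
    · exact Finset.sum_congr rfl fun i _ => by ring
  simp_rw [e]
  rw [integral_const_mul, h, ← Complex.exp_add, ← Complex.exp_add]
  congr 1
  rw [EuclideanSpace.real_norm_sq_eq u]
  have ht : ((‖t‖ : ℝ) : ℂ) ^ 2 = ∑ i, (t i : ℂ) ^ 2 := by
    rw [← Complex.ofReal_pow, EuclideanSpace.real_norm_sq_eq]; push_cast; rfl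
  rw [ht]
  simp only [PiLp.inner_apply, RCLike.inner_apply, conj_trivial]
  push_cast
  rw [neg_div, Finset.sum_div, Finset.sum_div, Finset.sum_mul, ← Finset.sum_neg_distrib,
    ← Finset.sum_neg_distrib, ← Finset.sum_add_distrib, ← Finset.sum_add_distrib]
  refine Finset.sum_congr rfl fun i _ => ?_
  linear_combination (-(t i : ℂ) ^ 2 / 2) * Complex.I_sq

theorem lintegral_exp_inner_stdGaussian (u : Vec n) :
    ∫⁻ x, ENNReal.ofReal (Real.exp ⟪u, x⟫) ∂(stdGaussian (Vec n))
      = ENNReal.ofReal (Real.exp (‖u‖ ^ 2 / 2)) := by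
  have h : ∫⁻ x, ENNReal.ofReal (Real.exp (⟪u, x⟫ - ‖u‖ ^ 2 / 2)) ∂(stdGaussian (Vec n)) = 1 := by
    have := Measure.isProbabilityMeasure_map (μ := stdGaussian (Vec n))
      (f := (· + u)) (by fun_prop)
    rw [← setLIntegral_univ, ← withDensity_apply _ MeasurableSet.univ,
      ← map_add_const_stdGaussian, measure_univ]
  have e : ∀ x : Vec n, ENNReal.ofReal (Real.exp ⟪u, x⟫) = ENNReal.ofReal
      (Real.exp (‖u‖ ^ 2 / 2)) * ENNReal.ofReal (Real.exp (⟪u, x⟫ - ‖u‖ ^ 2 / 2)) := by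
    intro x
    rw [← ENNReal.ofReal_mul (Real.exp_pos _).le, ← Real.exp_add]
    congr 2; ring
  simp_rw [e]
  rw [lintegral_const_mul _ (by fun_prop), h, mul_one]

/-- Shifting a standard Gaussian measure by `u` changes probabilities in a controlled way. -/
theorem stdGaussian_shift_sq_le (u : Vec n) {A : Set (Vec n)} (hA : MeasurableSet A) :
    (stdGaussian (Vec n) ((· + u) ⁻¹' A)) ^ 2
      ≤ ENNReal.ofReal (Real.exp (‖u‖ ^ 2)) * stdGaussian (Vec n) A := by
  set γ := stdGaussian (Vec n)
  set L : Vec n → ℝ≥0∞ := fun x => ENNReal.ofReal (Real.exp (⟪u, x⟫ - ‖u‖ ^ 2 / 2))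
  have h1 : γ ((· + u) ⁻¹' A) = ∫⁻ x, (L * A.indicator (1 : Vec n → ℝ≥0∞)) x ∂γ := by
    rw [← Measure.map_apply (by fun_prop) hA, map_add_const_stdGaussian, withDensity_apply _ hA,
      ← lintegral_indicator hA]
    refine lintegral_congr fun x => ?_
    by_cases hx : x ∈ A <;> simp [hx, L]
  have h2 : ∫⁻ x, L x ^ (2 : ℝ) ∂γ = ENNReal.ofReal (Real.exp (‖u‖ ^ 2)) := by
    have e : ∀ x : Vec n, L x ^ (2 : ℝ) = ENNReal.ofReal (Real.exp (-‖u‖ ^ 2)) *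
        ENNReal.ofReal (Real.exp ⟪(2 : ℝ) • u, x⟫) := by
      intro x
      rw [← ENNReal.ofReal_mul (Real.exp_pos _).le, ← Real.exp_add,
        ENNReal.ofReal_rpow_of_pos (Real.exp_pos _), ← Real.exp_mul, real_inner_smul_left]
      congr 2; ring
    simp_rw [e]
    rw [lintegral_const_mul _ (by fun_prop), lintegral_exp_inner_stdGaussian,
      ← ENNReal.ofReal_mul (Real.exp_pos _).le, ← Real.exp_add, norm_smul]
    congr 2; norm_num; ring
  -- Cauchy–Schwarz for the density `L` against the indicator of `A`; the second moment of `L` is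
  -- `exp(‖u‖²)`.
  have h3 := ENNReal.lintegral_mul_le_Lp_mul_Lq γ Real.HolderConjugate.two_two
    (f := L) (g := A.indicator (1 : Vec n → ℝ≥0∞)) (by fun_prop) (measurable_one.indicator hA).aemeasurable
  have h4 : ∫⁻ x, A.indicator (1 : Vec n → ℝ≥0∞) x ^ (2 : ℝ) ∂γ = γ A := by
    rw [← lintegral_indicator_one hA]
    refine lintegral_congr fun x => ?_
    by_cases hx : x ∈ A <;> simp [hx]
  rw [h2, h4] at h3
  rw [h1]
  calc _ ≤ _ := pow_le_pow_left' h3 2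
    _ = _ := by
      rw [← ENNReal.mul_rpow_of_nonneg _ _ (by norm_num), ← ENNReal.rpow_natCast,
        ← ENNReal.rpow_mul]
      norm_num

end Gaussian

/-! ### Gaussian concentration by rotation -/

section GaussianConcentration

variable {n : ℕ}

theorem exp_intervalIntegral_le {φ : ℝ → ℝ} (hφ : Continuous φ) :
    ENNReal.ofReal (Real.exp (∫ s in (0 : ℝ)..1, φ s))
      ≤ ∫⁻ s in Set.Ioc (0 : ℝ) 1, ENNReal.ofReal (Real.exp (φ s)) := by
  have : IsProbabilityMeasure (volume.restrict (Set.Ioc (0 : ℝ) 1)) := ⟨by simp⟩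
  have i1 : Integrable φ (volume.restrict (Set.Ioc (0 : ℝ) 1)) :=
    (hφ.integrableOn_Icc).mono_set Set.Ioc_subset_Icc_self
  have i2 : Integrable (fun s => Real.exp (φ s)) (volume.restrict (Set.Ioc (0 : ℝ) 1)) :=
    ((Real.continuous_exp.comp hφ).integrableOn_Icc).mono_set Set.Ioc_subset_Icc_self
  rw [← ofReal_integral_eq_lintegral_ofReal i2 (ae_of_all _ fun s => (Real.exp_pos _).le),
    intervalIntegral.integral_of_le zero_le_one]
  exact ENNReal.ofReal_le_ofReal (convexOn_exp.map_integral_le Real.continuous_exp.continuousOn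
    isClosed_univ (by simp) i1 i2)

theorem exists_inner_eq_fderiv {G : Vec n → ℝ} (hL : LipschitzWith 1 G) (x : Vec n) :
    ∃ u : Vec n, ‖u‖ ≤ 1 ∧ ∀ y, fderiv ℝ G x y = ⟪u, y⟫ := by
  refine ⟨(InnerProductSpace.toDual ℝ (Vec n)).symm (fderiv ℝ G x), ?_, fun y => ?_⟩
  · rw [LinearIsometryEquiv.norm_map]
    simpa using norm_fderiv_le_of_lipschitz ℝ hL (x₀ := x)
  · rw [InnerProductSpace.toDual_symm_apply]

/-- The exponential moments of the increments of a smooth Lipschitz function of a Gaussian vector,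
by interpolation along rotations. -/
theorem lintegral_exp_sub_le_of_contDiff {G : Vec n → ℝ} (hG : ContDiff ℝ 1 G)
    (hL : LipschitzWith 1 G) (l : ℝ) :
    ∫⁻ p, ENNReal.ofReal (Real.exp (l * (G p.2 - G p.1)))
        ∂((stdGaussian (Vec n)).prod (stdGaussian (Vec n)))
      ≤ ENNReal.ofReal (Real.exp (Real.pi ^ 2 / 8 * l ^ 2)) := by
  set γ := stdGaussian (Vec n)
  have hD : Continuous (fderiv ℝ G) := hG.continuous_fderiv (by norm_num)
  set H : Vec n × Vec n → ℝ := fun p => l * (Real.pi / 2) * fderiv ℝ G p.1 p.2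
  have hH : Continuous H := by fun_prop
  set R : ℝ → Vec n × Vec n → Vec n × Vec n := fun s p =>
    ContinuousLinearMap.rotation (Real.pi / 2 * s) p
  have hR : Continuous fun q : (Vec n × Vec n) × ℝ => R q.2 q.1 := by
    simp only [R, ContinuousLinearMap.rotation_apply]
    fun_prop
  have hHR : Continuous fun q : (Vec n × Vec n) × ℝ => H (R q.2 q.1) := hH.comp hR
  have hline : ∀ p, Continuous fun s => H (R s p) := fun p => by
    have h := hHR.comp (Continuous.prodMk_right p : Continuous fun s : ℝ => (p, s))
    exact h
  -- Rotation moves the first component from `p.1` to `p.2` through a quarter turn, with velocity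
  -- `π/2` times the second component.
  have key : ∀ p, l * (G p.2 - G p.1) = ∫ s in (0 : ℝ)..1, H (R s p) := by
    intro p
    have hd : ∀ s ∈ Set.uIcc (0 : ℝ) 1, HasDerivAt (fun s => l * G (R s p).1) (H (R s p)) s := by
      intro s _
      have h1 : HasDerivAt (fun s => (R s p).1) ((Real.pi / 2) • (R s p).2) s := by
        simp only [R, ContinuousLinearMap.rotation_apply]
        have hl : HasDerivAt (fun s : ℝ => Real.pi / 2 * s) (Real.pi / 2) s := by
          simpa using (hasDerivAt_id s).const_mul (Real.pi / 2)
        refine ((hl.cos.smul_const p.1).add (hl.sin.smul_const p.2)).congr_deriv ?_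
        rw [smul_add, smul_smul, smul_smul]
        congr 2 <;> ring
      have h2 := ((hG.differentiable (by norm_num)) (R s p).1).hasFDerivAt.comp_hasDerivAt s h1
      refine (h2.const_mul l).congr_deriv ?_
      simp only [H, map_smul, smul_eq_mul]
      ring
    rw [intervalIntegral.integral_eq_sub_of_hasDerivAt hd ((hline p).intervalIntegrable _ _)]
    simp [R, ContinuousLinearMap.rotation_apply, mul_sub]
  have hγ0 : γ[id] = 0 := integral_id_stdGaussian
  calc ∫⁻ p, ENNReal.ofReal (Real.exp (l * (G p.2 - G p.1))) ∂(γ.prod γ)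
      ≤ ∫⁻ p, (∫⁻ s in Set.Ioc (0 : ℝ) 1, ENNReal.ofReal (Real.exp (H (R s p)))) ∂(γ.prod γ) := by
        refine lintegral_mono fun p => ?_
        rw [key p]
        exact exp_intervalIntegral_le (hline p)
    _ = ∫⁻ s in Set.Ioc (0 : ℝ) 1, ∫⁻ p, ENNReal.ofReal (Real.exp (H (R s p))) ∂(γ.prod γ) := by
        refine lintegral_lintegral_swap ?_
        exact (ENNReal.continuous_ofReal.comp
          (Real.continuous_exp.comp hHR)).measurable.aemeasurable
    -- The product Gaussian is rotation invariant, so the inner integral does not depend on `s`.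
    _ = ∫⁻ s in Set.Ioc (0 : ℝ) 1, ∫⁻ p, ENNReal.ofReal (Real.exp (H p)) ∂(γ.prod γ) := by
        refine lintegral_congr fun s => ?_
        conv_rhs => rw [← IsGaussian.map_rotation_eq_self hγ0 (Real.pi / 2 * s)]
        rw [lintegral_map (by fun_prop) (by fun_prop)]
    _ ≤ ∫⁻ s in Set.Ioc (0 : ℝ) 1, ENNReal.ofReal (Real.exp (Real.pi ^ 2 / 8 * l ^ 2)) := by
        refine lintegral_mono fun s => ?_
        rw [lintegral_prod _ (by fun_prop)]
        calc _ ≤ ∫⁻ x, ENNReal.ofReal (Real.exp (Real.pi ^ 2 / 8 * l ^ 2)) ∂γ := by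
              refine lintegral_mono fun x => ?_
              -- For frozen `x`, `H (x, ·)` is a linear form of norm at most `|l| π/2`, whose
              -- Laplace transform is explicit.
              obtain ⟨u, hu, hGu⟩ := exists_inner_eq_fderiv hL x
              have e : ∀ y, H (x, y) = ⟪(l * (Real.pi / 2)) • u, y⟫ := by
                intro y
                rw [real_inner_smul_left, ← hGu]
              simp_rw [e]
              rw [lintegral_exp_inner_stdGaussian, norm_smul, mul_pow, Real.norm_eq_abs, sq_abs]
              refine ENNReal.ofReal_le_ofReal (Real.exp_le_exp.2 ?_)
              have : ‖u‖ ^ 2 ≤ 1 := pow_le_one₀ (norm_nonneg _) hu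
              nlinarith [sq_nonneg (l * (Real.pi / 2))]
          _ = _ := by simp
    _ = _ := by simp

/-- A Lipschitz function is a uniform limit of smooth Lipschitz functions. -/
theorem exists_contDiff_lipschitz_approx {G : Vec n → ℝ} (hL : LipschitzWith 1 G) {η : ℝ}
    (hη : 0 < η) :
    ∃ g : Vec n → ℝ, ContDiff ℝ 1 g ∧ LipschitzWith 1 g ∧ ∀ x, |g x - G x| ≤ η := by
  -- Mollification averages translates of `G` by vectors of length at most `η`, which preserves the
  -- Lipschitz constant.
  let φ : ContDiffBump (0 : Vec n) := ⟨η / 2, η, by positivity, by linarith⟩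
  let g : Vec n → ℝ := convolution (φ.normed volume) G (ContinuousLinearMap.lsmul ℝ ℝ) volume
  have hg : ∀ x, g x = ∫ t, φ.normed volume t * G (x - t) := fun x => rfl
  have hcont := hL.continuous
  have hint : ∀ x, Integrable fun t => φ.normed volume t * G (x - t) := fun x =>
    (φ.continuous_normed.mul (by fun_prop)).integrable_of_hasCompactSupport
      (φ.hasCompactSupport_normed.mul_right)
  refine ⟨g, ?_, ?_, fun x => ?_⟩
  · exact_mod_cast φ.hasCompactSupport_normed.contDiff_convolution_left (n := 1) _
      φ.contDiff_normed hcont.locallyIntegrable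
  · refine LipschitzWith.of_dist_le_mul fun x y => ?_
    rw [hg, hg, dist_eq_norm, ← integral_sub (hint x) (hint y)]
    have hb : Integrable fun t => φ.normed volume t * dist x y :=
      φ.integrable_normed.mul_const _
    calc _ ≤ ∫ t, φ.normed volume t * dist x y := by
          refine norm_integral_le_of_norm_le hb (ae_of_all _ fun t => ?_)
          rw [← mul_sub, norm_mul, Real.norm_of_nonneg (φ.nonneg_normed t)]
          refine mul_le_mul_of_nonneg_left ?_ (φ.nonneg_normed t)
          rw [← dist_eq_norm]
          simpa using hL.dist_le_mul (x - t) (y - t)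
      _ = _ := by rw [integral_mul_const, φ.integral_normed]; simp
  · rw [← Real.dist_eq]
    refine φ.dist_normed_convolution_le hcont.aestronglyMeasurable fun y hy => ?_
    have := hL.dist_le_mul y x
    rw [NNReal.coe_one, one_mul] at this
    exact this.trans (Metric.mem_ball.1 hy).le

theorem lintegral_exp_sub_le_of_lipschitz {G : Vec n → ℝ} (hL : LipschitzWith 1 G) {l : ℝ}
    (hl : 0 ≤ l) :
    ∫⁻ p, ENNReal.ofReal (Real.exp (l * (G p.2 - G p.1)))
        ∂((stdGaussian (Vec n)).prod (stdGaussian (Vec n)))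
      ≤ ENNReal.ofReal (Real.exp (Real.pi ^ 2 / 8 * l ^ 2)) := by
  have hbound : ∀ η : ℝ, 0 < η →
      ∫⁻ p, ENNReal.ofReal (Real.exp (l * (G p.2 - G p.1)))
        ∂((stdGaussian (Vec n)).prod (stdGaussian (Vec n)))
      ≤ ENNReal.ofReal (Real.exp (2 * l * η + Real.pi ^ 2 / 8 * l ^ 2)) := by
    intro η hη
    obtain ⟨g, hg, hgL, hgG⟩ := exists_contDiff_lipschitz_approx hL hη
    have hgc := hg.continuous
    calc _ ≤ ∫⁻ p, ENNReal.ofReal (Real.exp (2 * l * η)) *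
            ENNReal.ofReal (Real.exp (l * (g p.2 - g p.1)))
            ∂((stdGaussian (Vec n)).prod (stdGaussian (Vec n))) := by
          refine lintegral_mono fun p => ?_
          rw [← ENNReal.ofReal_mul (Real.exp_pos _).le, ← Real.exp_add]
          refine ENNReal.ofReal_le_ofReal (Real.exp_le_exp.2 ?_)
          have h1 := abs_le.1 (hgG p.1)
          have h2 := abs_le.1 (hgG p.2)
          have : G p.2 - G p.1 ≤ 2 * η + (g p.2 - g p.1) := by linarith
          nlinarith [mul_le_mul_of_nonneg_left this hl]
      _ ≤ _ := by
          rw [lintegral_const_mul _ (by fun_prop), Real.exp_add,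
            ENNReal.ofReal_mul (Real.exp_pos _).le]
          exact mul_le_mul_right (lintegral_exp_sub_le_of_contDiff hg hgL l) _
  have hlim : Filter.Tendsto
      (fun η : ℝ => ENNReal.ofReal (Real.exp (2 * l * η + Real.pi ^ 2 / 8 * l ^ 2)))
      (nhdsWithin 0 (Set.Ioi 0)) (nhds (ENNReal.ofReal (Real.exp (Real.pi ^ 2 / 8 * l ^ 2)))) := by
    have hc : Continuous
        (fun η : ℝ => ENNReal.ofReal (Real.exp (2 * l * η + Real.pi ^ 2 / 8 * l ^ 2))) :=
      ENNReal.continuous_ofReal.comp (by fun_prop)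
    simpa using (hc.tendsto 0).mono_left nhdsWithin_le_nhds
  exact ge_of_tendsto hlim (Filter.eventually_of_mem self_mem_nhdsWithin hbound)

theorem integrable_of_lipschitz_stdGaussian {G : Vec n → ℝ} (hL : LipschitzWith 1 G) :
    Integrable G (stdGaussian (Vec n)) := by
  have h : Integrable (fun x : Vec n => |G 0| + ‖x‖) (stdGaussian (Vec n)) :=
    (integrable_const _).add IsGaussian.integrable_id.norm
  refine h.mono' hL.continuous.aestronglyMeasurable (ae_of_all _ fun x => ?_)
  have := hL.dist_le_mul x 0
  rw [NNReal.coe_one, one_mul, dist_zero_right, Real.dist_eq] at this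
  have h2 := abs_sub_abs_le_abs_sub (G x) (G 0)
  rw [Real.norm_eq_abs]
  linarith

theorem stdGaussian_upper_tail {G : Vec n → ℝ} (hL : LipschitzWith 1 G) {t : ℝ} (ht : 0 ≤ t) :
    stdGaussian (Vec n) {ξ | t ≤ G ξ - ∫ ζ, G ζ ∂(stdGaussian (Vec n))}
      ≤ ENNReal.ofReal (Real.exp (-(2 / Real.pi ^ 2) * t ^ 2)) := by
  set γ := stdGaussian (Vec n)
  set m := ∫ ζ, G ζ ∂γ
  have hGc := hL.continuous
  have hGi := integrable_of_lipschitz_stdGaussian hL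
  -- Minimizer of the Chernoff exponent `π² l² / 8 - l t`.
  set l := 4 * t / Real.pi ^ 2
  have hl : 0 ≤ l := by positivity
  have h1 := lintegral_exp_sub_le_of_lipschitz hL hl
  rw [lintegral_prod_symm _ (by fun_prop)] at h1
  -- Jensen in the independent copy `x` replaces `G x` by its mean; where the exponential is not
  -- integrable the bound is infinite.
  have h2 : ∫⁻ y, ENNReal.ofReal (Real.exp (l * (G y - m))) ∂γ
      ≤ ENNReal.ofReal (Real.exp (Real.pi ^ 2 / 8 * l ^ 2)) := by
    refine le_trans (lintegral_mono fun y => ?_) h1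
    by_cases hi : Integrable (fun x => Real.exp (l * (G y - G x))) γ
    · rw [← ofReal_integral_eq_lintegral_ofReal hi (ae_of_all _ fun s => (Real.exp_pos _).le)]
      have hi' : Integrable (fun x => l * (G y - G x)) γ :=
        ((integrable_const _).sub hGi).const_mul l
      have := convexOn_exp.map_integral_le Real.continuous_exp.continuousOn
        isClosed_univ (by simp) hi' hi
      rw [integral_const_mul, integral_sub (integrable_const _) hGi] at this
      simp only [integral_const, probReal_univ, one_smul] at this
      exact ENNReal.ofReal_le_ofReal this
    · have : ∫⁻ x, ENNReal.ofReal (Real.exp (l * (G y - G x))) ∂γ = ⊤ := by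
        by_contra hne
        refine hi ⟨by fun_prop, ?_⟩
        rw [hasFiniteIntegral_iff_ofReal (ae_of_all _ fun s => (Real.exp_pos _).le)]
        exact lt_top_iff_ne_top.2 hne
      rw [this]; exact le_top
  have h3 : γ {ξ | t ≤ G ξ - m} ≤ ENNReal.ofReal (Real.exp (-(l * t))) *
      ∫⁻ y, ENNReal.ofReal (Real.exp (l * (G y - m))) ∂γ := by
    rw [← lintegral_const_mul _ (by fun_prop), ← lintegral_indicator_one
      (measurableSet_le (by fun_prop) (by fun_prop))]
    refine lintegral_mono fun y => ?_
    by_cases hy : t ≤ G y - m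
    · rw [Set.indicator_of_mem (show y ∈ {a | t ≤ G a - m} from hy), ← ENNReal.ofReal_mul (Real.exp_pos _).le, ← Real.exp_add,
        Pi.one_apply, ENNReal.one_le_ofReal, Real.one_le_exp_iff]
      nlinarith
    · rw [Set.indicator_of_notMem (show y ∉ {a | t ≤ G a - m} from hy)]; exact zero_le
  refine h3.trans ((mul_le_mul_right h2 _).trans ?_)
  rw [← ENNReal.ofReal_mul (Real.exp_pos _).le, ← Real.exp_add]
  refine ENNReal.ofReal_le_ofReal (Real.exp_le_exp.2 (le_of_eq ?_))
  simp only [l]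
  have := Real.pi_ne_zero
  field_simp
  ring

/-- Gaussian concentration of measure for Lipschitz functions. -/
theorem lipschitzConcentration_stdGaussian (n : ℕ) :
    LipschitzConcentration (2 / Real.pi ^ 2) (stdGaussian (Vec n)) := by
  intro G hL
  refine ⟨integrable_of_lipschitz_stdGaussian hL, fun t ht => ?_⟩
  have h1 := stdGaussian_upper_tail hL ht
  have h2 := stdGaussian_upper_tail hL.neg ht
  simp only [Pi.neg_apply, integral_neg] at h2
  refine (measure_mono (fun ξ hξ => ?_)).trans ((measure_union_le _ _).trans
    ((add_le_add h1 h2).trans (le_of_eq ?_)))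
  · rcases le_abs.1 (show t ≤ |G ξ - _| from hξ) with h | h
    · exact Or.inl h
    · refine Or.inr ?_
      change t ≤ -G ξ - -_
      linarith
  · rw [← ENNReal.ofReal_add (Real.exp_pos _).le (Real.exp_pos _).le, two_mul]

theorem LipschitzConcentration.mono {c c' : ℝ} (h : c' ≤ c) {μ : Measure (Vec n)}
    (hμ : LipschitzConcentration c μ) : LipschitzConcentration c' μ := by
  intro G hG
  refine ⟨(hμ G hG).1, fun t ht => ((hμ G hG).2 t ht).trans (ENNReal.ofReal_le_ofReal ?_)⟩
  have := mul_le_mul_of_nonneg_right h (sq_nonneg t)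
  have : Real.exp (-c * t ^ 2) ≤ Real.exp (-c' * t ^ 2) := Real.exp_le_exp.2 (by linarith)
  linarith

end GaussianConcentration

/-! ### Projection onto a convex set -/

section Projection

variable {E : Type*} [NormedAddCommGroup E] [InnerProductSpace ℝ E] {K : Set E}

theorem inner_sub_le_zero_of_nearest (hK : Convex ℝ K) {w p : E} (hp : p ∈ K)
    (hmin : ∀ k ∈ K, ‖w - p‖ ≤ ‖w - k‖) {k : E} (hk : k ∈ K) : ⟪w - p, k - p⟫ ≤ 0 := by
  refine (norm_eq_iInf_iff_real_inner_le_zero hK hp).1 ?_ k hk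
  have : Nonempty K := ⟨⟨p, hp⟩⟩
  refine le_antisymm (le_ciInf fun k => hmin k k.2) ?_
  exact ciInf_le ⟨0, by rintro _ ⟨k, rfl⟩; exact norm_nonneg _⟩ (⟨p, hp⟩ : K)

/-- The angle at the projection is obtuse, which turns Pythagoras into an inequality. -/
theorem norm_sub_sq_le_of_nearest (hK : Convex ℝ K) {w p : E} (hp : p ∈ K)
    (hmin : ∀ k ∈ K, ‖w - p‖ ≤ ‖w - k‖) {k : E} (hk : k ∈ K) :
    ‖k - p‖ ^ 2 ≤ ‖w - k‖ ^ 2 - ‖w - p‖ ^ 2 := by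
  have h := inner_sub_le_zero_of_nearest hK hp hmin hk
  have e : w - k = (w - p) - (k - p) := by abel
  rw [e, norm_sub_sq_real (w - p)]
  linarith

/-- Adding the two variational inequalities gives `‖p - p'‖² ≤ ⟪w - w', p - p'⟫`; Cauchy–Schwarz
finishes. -/
theorem norm_sub_le_of_nearest (hK : Convex ℝ K) {w p w' p' : E} (hp : p ∈ K) (hp' : p' ∈ K)
    (hmin : ∀ k ∈ K, ‖w - p‖ ≤ ‖w - k‖) (hmin' : ∀ k ∈ K, ‖w' - p'‖ ≤ ‖w' - k‖) :
    ‖p - p'‖ ≤ ‖w - w'‖ := by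
  have h1 := inner_sub_le_zero_of_nearest hK hp hmin hp'
  have h2 := inner_sub_le_zero_of_nearest hK hp' hmin' hp
  have h3 := real_inner_le_norm (w - w') (p - p')
  have h4 : ‖p - p'‖ ^ 2 ≤ ⟪w - w', p - p'⟫ := by
    rw [← real_inner_self_eq_norm_sq]
    have e : ⟪w - w', p - p'⟫ = ⟪p - p', p - p'⟫ - ⟪w - p, p' - p⟫ - ⟪w' - p', p - p'⟫ := by
      simp only [inner_sub_left, inner_sub_right]; ring
    linarith
  by_contra hlt
  push Not at hlt
  nlinarith [norm_nonneg (w - w'), norm_nonneg (p - p')]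

end Projection

/-- Pigeonhole; subadditivity of the outer measure suffices, so no set need be measurable. -/
theorem exists_measure_le_card_mul {α β : Type*} [MeasurableSpace α] (μ : Measure α)
    {S : Finset β} (hS : S.Nonempty) {A : Set α} {B : β → Set α} (hA : ∀ x ∈ A, ∃ g ∈ S, x ∈ B g) :
    ∃ g ∈ S, μ A ≤ S.card * μ (B g) := by
  obtain ⟨g, hg, hmax⟩ := S.exists_max_image (fun g => μ (B g)) hS
  refine ⟨g, hg, ?_⟩
  calc μ A ≤ μ (⋃ g ∈ S, B g) := measure_mono fun x hx => by simpa using hA x hx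
    _ ≤ ∑ g ∈ S, μ (B g) := measure_biUnion_finset_le _ _
    _ ≤ ∑ _i ∈ S, μ (B g) := Finset.sum_le_sum hmax
    _ = _ := by simp

/-! ### Concentration of a `1/√n`-Lipschitz map and its centers -/

section Concentration

variable {n : ℕ} {cL : ℝ} {μ : Measure (Vec n)} {Z : Vec n → Vec n}

theorem continuous_of_sqrt_mul_norm_sub_le (hn : 1 ≤ n)
    (hZ : ∀ ξ ζ, √n * ‖Z ξ - Z ζ‖ ≤ ‖ξ - ζ‖) : Continuous Z := by
  have h1 : (1 : ℝ) ≤ √n := Real.one_le_sqrt.2 (by exact_mod_cast hn)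
  refine (LipschitzWith.of_dist_le_mul (K := 1) fun ξ ζ => ?_).continuous
  rw [dist_eq_norm, dist_eq_norm, NNReal.coe_one, one_mul]
  exact (le_mul_of_one_le_left (norm_nonneg _) h1).trans (hZ ξ ζ)

theorem lipschitzWith_sqrt_mul_norm_sub (hZ : ∀ ξ ζ, √n * ‖Z ξ - Z ζ‖ ≤ ‖ξ - ζ‖) (g : Vec n) :
    LipschitzWith 1 fun ξ => √n * ‖Z ξ - g‖ := by
  refine LipschitzWith.of_dist_le_mul fun ξ ζ => ?_
  rw [Real.dist_eq, ← mul_sub, abs_mul, abs_of_nonneg (Real.sqrt_nonneg _), NNReal.coe_one,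
    one_mul, dist_eq_norm]
  refine le_trans (mul_le_mul_of_nonneg_left ?_ (Real.sqrt_nonneg _)) (hZ ξ ζ)
  simpa using abs_norm_sub_norm_le (Z ξ - g) (Z ζ - g)

theorem integrable_norm_sub (hn : 1 ≤ n) (hμ : LipschitzConcentration cL μ)
    (hZ : ∀ ξ ζ, √n * ‖Z ξ - Z ζ‖ ≤ ‖ξ - ζ‖) (g : Vec n) :
    Integrable (fun ξ => ‖Z ξ - g‖) μ := by
  have h0 : √(n : ℝ) ≠ 0 := (Real.sqrt_pos.2 (by exact_mod_cast hn)).ne'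
  have h := ((hμ _ (lipschitzWith_sqrt_mul_norm_sub hZ g)).1).const_mul (√(n : ℝ))⁻¹
  simpa [← mul_assoc, h0] using h

theorem integrable_of_sqrt_mul_norm_sub_le (hn : 1 ≤ n) (hμ : LipschitzConcentration cL μ)
    (hZ : ∀ ξ ζ, √n * ‖Z ξ - Z ζ‖ ≤ ‖ξ - ζ‖) : Integrable Z μ := by
  refine (integrable_norm_iff
    (continuous_of_sqrt_mul_norm_sub_le hn hZ).aestronglyMeasurable).1 ?_
  simpa using integrable_norm_sub hn hμ hZ 0

theorem measure_deviation_norm_sub_le (hn : 1 ≤ n) (hμ : LipschitzConcentration cL μ)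
    (hZ : ∀ ξ ζ, √n * ‖Z ξ - Z ζ‖ ≤ ‖ξ - ζ‖) (g : Vec n) {t : ℝ} (ht : 0 ≤ t) :
    μ {ξ | t ≤ |‖Z ξ - g‖ - ∫ ζ, ‖Z ζ - g‖ ∂μ|}
      ≤ ENNReal.ofReal (2 * Real.exp (-(cL * (n * t ^ 2)))) := by
  have h0 : 0 < √(n : ℝ) := Real.sqrt_pos.2 (by exact_mod_cast hn)
  have h := (hμ _ (lipschitzWith_sqrt_mul_norm_sub hZ g)).2 (√n * t) (by positivity)
  rw [mul_pow, Real.sq_sqrt (Nat.cast_nonneg n), neg_mul] at h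
  refine (measure_mono fun ξ hξ => ?_).trans h
  rw [Set.mem_ofPred_eq, integral_const_mul, ← mul_sub, abs_mul, abs_of_pos h0]
  exact mul_le_mul_of_nonneg_left hξ h0.le

/-- Were the mean above `ρ + t`, the event in `h` would be a deviation of size `t`, contradicting
concentration. -/
theorem integral_norm_sub_le_of_lt_measure (hn : 1 ≤ n) (hμ : LipschitzConcentration cL μ)
    (hZ : ∀ ξ ζ, √n * ‖Z ξ - Z ζ‖ ≤ ‖ξ - ζ‖) {g : Vec n} {ρ t : ℝ} (ht : 0 ≤ t)
    (h : ENNReal.ofReal (2 * Real.exp (-(cL * (n * t ^ 2)))) < μ {ξ | ‖Z ξ - g‖ ≤ ρ}) :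
    ∫ ξ, ‖Z ξ - g‖ ∂μ ≤ ρ + t := by
  by_contra hlt
  push Not at hlt
  refine absurd h (not_lt.2 ((measure_mono fun ξ hξ => ?_).trans
    (measure_deviation_norm_sub_le hn hμ hZ g ht)))
  have hξ' : ‖Z ξ - g‖ ≤ ρ := hξ
  change t ≤ |_|
  rw [abs_sub_comm]
  exact le_trans (by linarith) (le_abs_self _)

variable [IsProbabilityMeasure μ]

theorem norm_integral_sub_le (hn : 1 ≤ n) (hμ : LipschitzConcentration cL μ)
    (hZ : ∀ ξ ζ, √n * ‖Z ξ - Z ζ‖ ≤ ‖ξ - ζ‖) (g : Vec n) :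
    ‖g - ∫ ζ, Z ζ ∂μ‖ ≤ ∫ ξ, ‖Z ξ - g‖ ∂μ := by
  have hi := integrable_of_sqrt_mul_norm_sub_le hn hμ hZ
  have e : (∫ ζ, Z ζ ∂μ) - g = ∫ ζ, (Z ζ - g) ∂μ := by
    rw [integral_sub hi (integrable_const _)]; simp
  rw [norm_sub_rev, e]
  exact norm_integral_le_integral_norm _

/-- The variance is controlled by the distance to an arbitrary center, up to `1 / n`. -/
theorem lintegral_norm_sub_integral_sq_le (hn : 1 ≤ n) (hcL : 0 < cL)
    (hμ : LipschitzConcentration cL μ) (hZ : ∀ ξ ζ, √n * ‖Z ξ - Z ζ‖ ≤ ‖ξ - ζ‖) {g : Vec n} {m : ℝ}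
    (hm : ∫ ξ, ‖Z ξ - g‖ ∂μ ≤ m) :
    ∫⁻ ξ, ENNReal.ofReal (‖Z ξ - ∫ ζ, Z ζ ∂μ‖ ^ 2) ∂μ
      ≤ ENNReal.ofReal (8 * m ^ 2 + 4 / (cL * n)) := by
  have hn0 : (0 : ℝ) < n := by exact_mod_cast hn
  have hc := continuous_of_sqrt_mul_norm_sub_le hn hZ
  set e := ∫ ξ, ‖Z ξ - g‖ ∂μ
  have he : 0 ≤ e := integral_nonneg fun ξ => norm_nonneg _
  have hg : ‖g - ∫ ζ, Z ζ ∂μ‖ ≤ e := norm_integral_sub_le hn hμ hZ g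
  have hk : 0 < cL * n := by positivity
  -- Layer-cake formula with the tail `2 exp(-cL n t)` of the squared deviation.
  have h1 : ∫⁻ ξ, ENNReal.ofReal ((‖Z ξ - g‖ - e) ^ 2) ∂μ ≤ ENNReal.ofReal (2 / (cL * n)) := by
    rw [lintegral_eq_lintegral_meas_le μ (ae_of_all _ fun ξ => sq_nonneg _) (by fun_prop)]
    calc _ ≤ ∫⁻ t in Set.Ioi (0 : ℝ), ENNReal.ofReal (2 * Real.exp (-(cL * n) * t)) := by
          refine setLIntegral_mono (by fun_prop) fun t ht => ?_
          have ht' : 0 < t := ht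
          have h := measure_deviation_norm_sub_le hn hμ hZ g (Real.sqrt_nonneg t)
          rw [Real.sq_sqrt ht'.le] at h
          refine (measure_mono fun ξ hξ => ?_).trans (h.trans (le_of_eq ?_))
          · exact Real.sqrt_le_iff.2 ⟨abs_nonneg _, by rw [sq_abs]; exact hξ⟩
          · congr 3; ring
      _ = _ := by
          rw [← ofReal_integral_eq_lintegral_ofReal
            ((integrableOn_exp_mul_Ioi (by linarith) 0).const_mul 2)
            (ae_of_all _ fun t => by positivity), integral_const_mul,
            integral_exp_mul_Ioi (by linarith)]
          congr 1
          simp only [mul_zero, Real.exp_zero]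
          field_simp
  calc _ ≤ ∫⁻ ξ, (ENNReal.ofReal (8 * m ^ 2) + ENNReal.ofReal 2 * ENNReal.ofReal ((‖Z ξ - g‖ - e) ^ 2)) ∂μ := by
        refine lintegral_mono fun ξ => ?_
        rw [← ENNReal.ofReal_mul (by norm_num),
          ← ENNReal.ofReal_add (by positivity) (by positivity)]
        refine ENNReal.ofReal_le_ofReal ?_
        have h3 : ‖Z ξ - ∫ ζ, Z ζ ∂μ‖ ≤ (‖Z ξ - g‖ - e) + 2 * e :=
          (norm_sub_le_norm_sub_add_norm_sub _ g _).trans (by linarith)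
        have h4 := pow_le_pow_left₀ (norm_nonneg _) h3 2
        have h5 := pow_le_pow_left₀ he hm 2
        nlinarith [sq_nonneg ((‖Z ξ - g‖ - e) - 2 * e)]
    _ ≤ ENNReal.ofReal (8 * m ^ 2) + ENNReal.ofReal 2 * ENNReal.ofReal (2 / (cL * n)) := by
        rw [lintegral_add_left (by fun_prop), lintegral_const_mul _ (by fun_prop)]
        simp only [lintegral_const, measure_univ, mul_one]
        gcongr
    _ = _ := by
        rw [← ENNReal.ofReal_mul (by norm_num),
          ← ENNReal.ofReal_add (by positivity) (by positivity)]
        congr 1; ring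

/-- A finite cover of the range of `Z` whose cardinality is balanced with the concentration
localizes `Z` near one of the centers. -/
theorem exists_integral_norm_sub_le_of_cover (hn : 1 ≤ n) (hcL : 0 < cL)
    (hμ : LipschitzConcentration cL μ) (hZ : ∀ ξ ζ, √n * ‖Z ξ - Z ζ‖ ≤ ‖ξ - ζ‖)
    {b ε : ℝ} (hb : 0 < b) (hε : 0 < ε) {S : Finset (Vec n)} (hcov : ∀ ξ, ∃ g ∈ S, ‖Z ξ - g‖ ≤ ε)
    (hcard : 2 ≤ S.card) (hlog : Real.log S.card ≤ b * (n * ε ^ 2)) :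
    ∃ g, ∫ ξ, ‖Z ξ - g‖ ∂μ ≤ (1 + √((2 * b + 1) / cL)) * ε := by
  have hn0 : (0 : ℝ) < n := by exact_mod_cast hn
  have hcard' : (2 : ℝ) ≤ S.card := by exact_mod_cast hcard
  obtain ⟨g, -, hg⟩ := exists_measure_le_card_mul μ (A := Set.univ)
    (B := fun g => {ξ | ‖Z ξ - g‖ ≤ ε}) (Finset.card_pos.1 (by omega : 0 < S.card))
    (fun ξ _ => hcov ξ)
  refine ⟨g, ?_⟩
  rw [add_mul, one_mul]
  refine integral_norm_sub_le_of_lt_measure hn hμ hZ (by positivity) ?_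
  rw [measure_univ] at hg
  have h1 : ENNReal.ofReal (S.card : ℝ)⁻¹ ≤ μ {ξ | ‖Z ξ - g‖ ≤ ε} := by
    rw [ENNReal.ofReal_inv_of_pos (by linarith), ENNReal.ofReal_natCast]
    exact ENNReal.inv_le_iff_le_mul (by simp) (by simp) |>.2 hg
  refine lt_of_lt_of_le ?_ h1
  -- The constant makes `cL n t² = (2b + 1) nε²`. One `b` pays for `log S.card`, one for the factor
  -- `2` (as `2 ≤ S.card`), and the `1` gives strictness.
  rw [ENNReal.ofReal_lt_ofReal_iff (by positivity), mul_pow, Real.sq_sqrt (by positivity)]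
  have hlog2 : Real.log 2 ≤ Real.log S.card := Real.log_le_log (by norm_num) hcard'
  have hp : 0 < n * ε ^ 2 := by positivity
  have e : cL * (n * ((2 * b + 1) / cL * ε ^ 2)) = (2 * b + 1) * (n * ε ^ 2) := by
    field_simp
  rw [e]
  calc 2 * Real.exp (-((2 * b + 1) * (n * ε ^ 2)))
      = Real.exp (Real.log 2 - (2 * b + 1) * (n * ε ^ 2)) := by
        rw [sub_eq_add_neg, Real.exp_add, Real.exp_log (by norm_num)]
    _ < Real.exp (-Real.log S.card) := Real.exp_lt_exp.2 (by nlinarith)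
    _ = _ := by rw [Real.exp_neg, Real.exp_log (by linarith)]

end Concentration

/-! ### Lower bounds for the risk -/

section Minimax

variable {n : ℕ} {K : Set (Vec n)} {W : Vec n → Vec n} {R : ℝ}

/-- If an estimator `W` is accurate at `v`, then it hits a neighbourhood of `v` with substantial
probability under any nearby distribution. -/
theorem le_measure_estimator_mem_ball (hW : Measurable W) {v : Vec n}
    (hR : ∫⁻ ξ, ENNReal.ofReal (‖v - W (√n • v + ξ)‖ ^ 2) ∂(stdGaussian (Vec n))
      ≤ ENNReal.ofReal R) {ρ : ℝ} (hρ : 0 < ρ) (hRρ : 8 * R ≤ ρ ^ 2) (g : Vec n) :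
    ENNReal.ofReal (49 / 64 * Real.exp (-(n * ‖v - g‖ ^ 2)))
      ≤ stdGaussian (Vec n) {ξ | W (√n • g + ξ) ∈ Metric.ball v ρ} := by
  set γ := stdGaussian (Vec n)
  have hmeas : ∀ g, MeasurableSet {ξ | W (√n • g + ξ) ∈ Metric.ball v ρ} := fun g =>
    (hW.comp (by fun_prop : Measurable fun ξ => √n • g + ξ)) Metric.isOpen_ball.measurableSet
  have hpos : 0 < ENNReal.ofReal (ρ ^ 2) := ENNReal.ofReal_pos.2 (by positivity)
  -- Markov: the miss probability at `v` is at most `R / ρ² ≤ 1/8`. Moving the mean to `g` then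
  -- squares `7/8` and costs `exp(n‖v - g‖²)`.
  have h1 : γ {ξ | W (√n • v + ξ) ∈ Metric.ball v ρ}ᶜ ≤ ENNReal.ofReal (1 / 8) := by
    have h := (mul_meas_ge_le_lintegral₀ (μ := γ)
      (f := fun ξ => ENNReal.ofReal (‖v - W (√n • v + ξ)‖ ^ 2)) (by fun_prop)
      (ENNReal.ofReal (ρ ^ 2))).trans hR
    have hsub : {ξ | W (√n • v + ξ) ∈ Metric.ball v ρ}ᶜ ⊆
        {ξ | ENNReal.ofReal (ρ ^ 2) ≤ ENNReal.ofReal (‖v - W (√n • v + ξ)‖ ^ 2)} := by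
      intro ξ hξ
      have hξ' : ¬ dist (W (√n • v + ξ)) v < ρ := hξ
      rw [dist_comm, dist_eq_norm, not_lt] at hξ'
      exact ENNReal.ofReal_le_ofReal (pow_le_pow_left₀ hρ.le hξ' 2)
    refine (measure_mono hsub).trans ?_
    rw [mul_comm, ← ENNReal.le_div_iff_mul_le (Or.inl hpos.ne') (Or.inl ENNReal.ofReal_ne_top),
      ← ENNReal.ofReal_div_of_pos (by positivity)] at h
    refine h.trans (ENNReal.ofReal_le_ofReal ?_)
    rw [div_le_div_iff₀ (by positivity) (by norm_num)]
    linarith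
  have h2 : ENNReal.ofReal (7 / 8) ≤ γ {ξ | W (√n • v + ξ) ∈ Metric.ball v ρ} := by
    have h := prob_add_prob_compl (μ := γ) (hmeas v)
    have h' : (1 : ℝ≥0∞) ≤ γ {ξ | W (√n • v + ξ) ∈ Metric.ball v ρ} + ENNReal.ofReal (1 / 8) := by
      rw [← h]; gcongr
    rw [show (7 / 8 : ℝ) = 1 - 1 / 8 by norm_num, ENNReal.ofReal_sub _ (by norm_num),
      ENNReal.ofReal_one]
    exact tsub_le_iff_right.2 h'
  have h3 := stdGaussian_shift_sq_le (√n • (v - g)) (hmeas g)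
  have e : (fun ξ => ξ + √n • (v - g)) ⁻¹' {ξ | W (√n • g + ξ) ∈ Metric.ball v ρ}
      = {ξ | W (√n • v + ξ) ∈ Metric.ball v ρ} := by
    ext ξ
    have : √n • g + (ξ + √n • (v - g)) = √n • v + ξ := by rw [smul_sub]; abel
    simp only [Set.mem_preimage, Set.mem_ofPred_eq, this]
  rw [e, norm_smul, mul_pow, Real.norm_eq_abs, sq_abs, Real.sq_sqrt (Nat.cast_nonneg n)] at h3
  have h4 : ENNReal.ofReal (49 / 64) ≤ ENNReal.ofReal (Real.exp (n * ‖v - g‖ ^ 2)) *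
      γ {ξ | W (√n • g + ξ) ∈ Metric.ball v ρ} := by
    refine le_trans (le_of_eq ?_) ((pow_le_pow_left' h2 2).trans h3)
    rw [← ENNReal.ofReal_pow (by norm_num)]; norm_num
  calc _ = ENNReal.ofReal (Real.exp (-(n * ‖v - g‖ ^ 2))) * ENNReal.ofReal (49 / 64) := by
        rw [← ENNReal.ofReal_mul (Real.exp_pos _).le, mul_comm]
    _ ≤ _ := mul_le_mul_right h4 _
    _ = _ := by
        rw [← mul_assoc, ← ENNReal.ofReal_mul (Real.exp_pos _).le, ← Real.exp_add]
        simp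

/-- The two-point lower bound for the risk. -/
theorem sq_norm_sub_le_risk (hW : Measurable W)
    (hR : ∀ v ∈ K, ∫⁻ ξ, ENNReal.ofReal (‖v - W (√n • v + ξ)‖ ^ 2) ∂(stdGaussian (Vec n))
      ≤ ENNReal.ofReal R) {v w : Vec n} (hv : v ∈ K) (hw : w ∈ K)
    (hvw : v ≠ w) (hn : n * ‖v - w‖ ^ 2 ≤ 1) : ‖v - w‖ ^ 2 ≤ 32 * R := by
  by_contra hlt
  push Not at hlt
  have hδ : 0 < ‖v - w‖ := norm_pos_iff.2 (sub_ne_zero.2 hvw)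
  have h1 := le_measure_estimator_mem_ball hW (hR v hv) (half_pos hδ) (by nlinarith) w
  have h2 := le_measure_estimator_mem_ball hW (hR w hw) (half_pos hδ) (by nlinarith) w
  have hdisj : Disjoint {ξ | W (√n • w + ξ) ∈ Metric.ball v (‖v - w‖ / 2)}
      {ξ | W (√n • w + ξ) ∈ Metric.ball w (‖v - w‖ / 2)} := by
    have hb : Disjoint (Metric.ball v (‖v - w‖ / 2)) (Metric.ball w (‖v - w‖ / 2)) :=
      Metric.ball_disjoint_ball (by rw [dist_eq_norm]; linarith)
    exact hb.preimage fun ξ => W (√n • w + ξ)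
  have hm : MeasurableSet {ξ | W (√n • w + ξ) ∈ Metric.ball w (‖v - w‖ / 2)} :=
    (hW.comp (by fun_prop : Measurable fun ξ => √n • w + ξ)) Metric.isOpen_ball.measurableSet
  have h3 := (add_le_add h1 h2).trans ((measure_union hdisj hm).symm.le.trans prob_le_one)
  rw [← ENNReal.ofReal_add (by positivity) (by positivity), ENNReal.ofReal_le_one] at h3
  simp only [sub_self, norm_zero] at h3
  -- Two disjoint events would have total probability at least `(49/64)(1 + 1/e) > 1`.
  have h4 : Real.exp (-1) ≤ Real.exp (-(n * ‖v - w‖ ^ 2)) := Real.exp_le_exp.2 (by linarith)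
  have h5 := Real.exp_neg_one_gt_d9
  norm_num at h3
  linarith

/-- The risk dominates the local packing numbers. -/
theorem card_le_of_separated (hW : Measurable W)
    (hR : ∀ v ∈ K, ∫⁻ ξ, ENNReal.ofReal (‖v - W (√n • v + ξ)‖ ^ 2) ∂(stdGaussian (Vec n))
      ≤ ENNReal.ofReal R) {r : ℝ} (hr : 0 < r) (hRr : 2048 * R ≤ r ^ 2) (g : Vec n)
    {ι : Type*} (C : Finset ι) (v : ι → Vec n) (hC : ∀ i ∈ C, v i ∈ K ∧ ‖v i - g‖ ≤ r)
    (hsep : ∀ i ∈ C, ∀ j ∈ C, i ≠ j → r / 8 ≤ ‖v i - v j‖) :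
    (C.card : ℝ) ≤ 2 * Real.exp (n * r ^ 2) := by
  -- Half the separation, so the balls are disjoint; all are tested under the single law centered at
  -- `g`. The factor `2048` is `8 · 16²`.
  set A : ι → Set (Vec n) := fun i => {ξ | W (√n • g + ξ) ∈ Metric.ball (v i) (r / 16)}
  have hA : ∀ i, MeasurableSet (A i) := fun i =>
    (hW.comp (by fun_prop : Measurable fun ξ => √n • g + ξ)) Metric.isOpen_ball.measurableSet
  have hlow : ∀ i ∈ C, ENNReal.ofReal (49 / 64 * Real.exp (-(n * r ^ 2)))
      ≤ stdGaussian (Vec n) (A i) := by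
    intro i hi
    refine le_trans (ENNReal.ofReal_le_ofReal ?_) (le_measure_estimator_mem_ball hW
      (hR _ (hC i hi).1) (by positivity : 0 < r / 16) (by linarith) g)
    have := (hC i hi).2
    gcongr
  have hdisj : (C : Set ι).PairwiseDisjoint A := by
    intro i hi j hj hij
    have hb : Disjoint (Metric.ball (v i) (r / 16)) (Metric.ball (v j) (r / 16)) :=
      Metric.ball_disjoint_ball (by rw [dist_eq_norm]; linarith [hsep i hi j hj hij])
    exact hb.preimage fun ξ => W (√n • g + ξ)
  have hsum : ∑ _i ∈ C, ENNReal.ofReal (49 / 64 * Real.exp (-(n * r ^ 2))) ≤ 1 :=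
    (Finset.sum_le_sum hlow).trans
      ((measure_biUnion_finset hdisj fun i _ => hA i).symm.le.trans prob_le_one)
  rw [Finset.sum_const, nsmul_eq_mul, ← ENNReal.ofReal_natCast,
    ← ENNReal.ofReal_mul (Nat.cast_nonneg _), ENNReal.ofReal_le_one, Real.exp_neg] at hsum
  have he := Real.exp_pos (n * r ^ 2)
  field_simp at hsum
  linarith [(Nat.cast_nonneg C.card : (0 : ℝ) ≤ C.card)]

/-- By convexity, the bound on local packings at scale `r` gives finite covers at all larger
scales. -/
theorem exists_local_cover (hK : Convex ℝ K) (hW : Measurable W)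
    (hR : ∀ v ∈ K, ∫⁻ ξ, ENNReal.ofReal (‖v - W (√n • v + ξ)‖ ^ 2) ∂(stdGaussian (Vec n))
      ≤ ENNReal.ofReal R) {r s : ℝ} (hr : 0 < r) (hRr : 2048 * R ≤ r ^ 2) (hrs : r ≤ s)
    {g : Vec n} (hg : g ∈ K) :
    ∃ S : Finset (Vec n), S.Nonempty ∧ (∀ v ∈ S, v ∈ K) ∧
      (S.card : ℝ) ≤ 2 * Real.exp (n * r ^ 2) ∧
      ∀ v ∈ K, ‖v - g‖ ≤ s → ∃ w ∈ S, ‖v - w‖ ≤ s / 8 := by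
  classical
  have hs : 0 < s := hr.trans_le hrs
  let P : Finset (Vec n) → Prop := fun C => (∀ v ∈ C, v ∈ K ∧ ‖v - g‖ ≤ s) ∧
    ∀ v ∈ C, ∀ w ∈ C, v ≠ w → s / 8 < ‖v - w‖
  have hbound : ∀ C, P C → (C.card : ℝ) ≤ 2 * Real.exp (n * r ^ 2) := by
    intro C hC
    have hl0 : 0 ≤ r / s := by positivity
    have hl1 : r / s ≤ 1 := (div_le_one hs).2 hrs
    -- The homothety of center `g` and ratio `r/s` maps `K` into itself and brings an `s`-scale
    -- packing down to scale `r`.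
    refine card_le_of_separated hW hR hr hRr g C (fun v => g + (r / s) • (v - g))
      (fun v hv => ⟨hK.add_smul_sub_mem hg (hC.1 v hv).1 ⟨hl0, hl1⟩, ?_⟩) fun v hv w hw hvw => ?_
    · rw [add_sub_cancel_left, norm_smul, Real.norm_of_nonneg hl0]
      calc r / s * ‖v - g‖ ≤ r / s * s := mul_le_mul_of_nonneg_left (hC.1 v hv).2 hl0
        _ = r := by field_simp
    · rw [add_sub_add_left_eq_sub, ← smul_sub, sub_sub_sub_cancel_right, norm_smul,
        Real.norm_of_nonneg hl0]
      calc r / 8 = r / s * (s / 8) := by field_simp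
        _ ≤ _ := mul_le_mul_of_nonneg_left (hC.2 v hv w hw hvw).le hl0
  have hPg : P {g} := by
    refine ⟨fun v hv => ?_, fun v hv w hw hvw => ?_⟩
    · rw [Finset.mem_singleton.1 hv]; simpa using ⟨hg, hs.le⟩
    · exact absurd ((Finset.mem_singleton.1 hv).trans (Finset.mem_singleton.1 hw).symm) hvw
  obtain ⟨m, ⟨C, hC, hCm⟩, hmax⟩ : ∃ m, (∃ C, P C ∧ C.card = m) ∧ ∀ C, P C → C.card ≤ m := by
    have hb : ∀ m ∈ {m | ∃ C, P C ∧ C.card = m}, m ≤ ⌊2 * Real.exp (n * r ^ 2)⌋₊ := by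
      rintro _ ⟨C, hC, rfl⟩
      exact Nat.le_floor (hbound C hC)
    have hne : {m | ∃ C, P C ∧ C.card = m}.Nonempty := ⟨_, {g}, hPg, rfl⟩
    exact ⟨_, Nat.sSup_mem hne ⟨_, hb⟩, fun C hC => le_csSup ⟨_, hb⟩ ⟨C, hC, rfl⟩⟩
  refine ⟨C, Finset.card_pos.1 ?_, fun v hv => (hC.1 v hv).1, hbound C hC, fun v hv hvg => ?_⟩
  · have := hmax _ hPg
    rw [Finset.card_singleton] at this
    omega
  -- A maximal packing is a cover: an uncovered point could be added to it.
  · by_contra! hfar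
    have hvC : v ∉ C := fun h => by
      have := hfar v h
      rw [sub_self, norm_zero] at this
      linarith
    have hP : P (insert v C) := by
      refine ⟨fun w hw => ?_, fun w hw w' hw' hne => ?_⟩
      · rcases Finset.mem_insert.1 hw with rfl | hw
        · exact ⟨hv, hvg⟩
        · exact hC.1 w hw
      · rcases Finset.mem_insert.1 hw with rfl | hwC <;>
          rcases Finset.mem_insert.1 hw' with rfl | hwC'
        · exact absurd rfl hne
        · exact hfar w' hwC'
        · rw [norm_sub_rev]; exact hfar w hwC
        · exact hC.2 w hwC w' hwC' hne
    have := hmax _ hP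
    rw [Finset.card_insert_of_notMem hvC] at this
    omega

/-- In a convex set that is not too small, no estimator has risk of smaller order than `1 / n`. -/
theorem inv_le_risk (hn : 1 ≤ n) (hK : Convex ℝ K) (hW : Measurable W)
    (hR : ∀ v ∈ K, ∫⁻ ξ, ENNReal.ofReal (‖v - W (√n • v + ξ)‖ ^ 2) ∂(stdGaussian (Vec n))
      ≤ ENNReal.ofReal R) {κ : ℝ} (hκ0 : 0 < κ) (hκ1 : κ ≤ 1) {v w : Vec n} (hv : v ∈ K)
    (hw : w ∈ K) (hvw : κ ≤ ‖v - w‖) : κ ^ 2 / n ≤ 32 * R := by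
  have hn1 : (1 : ℝ) ≤ n := by exact_mod_cast hn
  have hs1 : (1 : ℝ) ≤ √n := Real.one_le_sqrt.2 hn1
  have hs : √(n : ℝ) ^ 2 = n := Real.sq_sqrt (by linarith)
  have hvw0 : 0 < ‖v - w‖ := hκ0.trans_le hvw
  -- Places the second point on the segment at distance exactly `κ/√n` from `w`, where the two-point
  -- bound applies.
  set l := κ / (√n * ‖v - w‖)
  have hl0 : 0 < l := by positivity
  have hl1 : l ≤ 1 := by
    refine (div_le_one (by positivity)).2 (hvw.trans ?_)
    exact le_mul_of_one_le_left hvw0.le hs1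
  have hnorm : ‖(w + l • (v - w)) - w‖ ^ 2 = κ ^ 2 / n := by
    rw [add_sub_cancel_left, norm_smul, Real.norm_of_nonneg hl0.le, mul_pow, div_pow, mul_pow, hs]
    field_simp
  have hne : w + l • (v - w) ≠ w := by
    intro h
    rw [h, sub_self, norm_zero] at hnorm
    have : 0 < κ ^ 2 / n := by positivity
    linarith
  have := sq_norm_sub_le_risk hW hR (hK.add_smul_sub_mem hw hv ⟨hl0.le, hl1⟩) hw hne
    (by rw [hnorm]; field_simp; exact pow_le_one₀ hκ0.le hκ1)
  rwa [hnorm] at this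

end Minimax

/-! ### Localization at the scale of the risk -/

section Localization

variable {n : ℕ} {K : Set (Vec n)} {cL R : ℝ} {μ : Measure (Vec n)} {Z W : Vec n → Vec n}

/-- A nonexpansive function of the noise is localized in `K` at the scale of the risk of any
estimator over `K`. -/
theorem exists_integral_norm_sub_lt_of_risk [IsProbabilityMeasure μ] (hn : 1 ≤ n) (hcL : 0 < cL)
    (hμ : LipschitzConcentration cL μ) (hZ : ∀ ξ ζ, √n * ‖Z ξ - Z ζ‖ ≤ ‖ξ - ζ‖)
    (hZK : ∀ ξ, Z ξ ∈ K) (hK : Convex ℝ K) (hW : Measurable W)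
    (hR : ∀ v ∈ K, ∫⁻ ξ, ENNReal.ofReal (‖v - W (√n • v + ξ)‖ ^ 2) ∂(stdGaussian (Vec n))
      ≤ ENNReal.ofReal R) {r : ℝ} (hr : 0 < r) (hRr : 2048 * R ≤ r ^ 2) (hnr : 3 ≤ n * r ^ 2) :
    ∃ g ∈ K, ∫ ξ, ‖Z ξ - g‖ ∂μ < (1 + 128 / cL) * r := by
  set L := 1 + 128 / cL
  have hL1 : 1 ≤ L := by simp only [L]; linarith [show 0 < 128 / cL by positivity]
  have hn0 : (0 : ℝ) < n := by exact_mod_cast hn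
  by_contra! hfar
  -- Improvement of a center: half of the mass lies within `s` of `g`, and pigeonhole over a local
  -- cover selects an `s/8`-ball of sufficient mass.
  have hshrink : ∀ s, L * r ≤ s → ∀ g ∈ K, ∫ ξ, ‖Z ξ - g‖ ∂μ ≤ s / 2 →
      ∃ g' ∈ K, ∫ ξ, ‖Z ξ - g'‖ ∂μ ≤ s / 4 := by
    intro s hs g hg hgs
    have hrs : r ≤ s := le_trans (le_mul_of_one_le_left hr.le hL1) hs
    have hs0 : 0 < s := hr.trans_le hrs
    obtain ⟨S, hSne, hSK, hScard, hScov⟩ := exists_local_cover hK hW hR hr hRr hrs hg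
    obtain ⟨g', hg'S, hg'⟩ := exists_measure_le_card_mul μ (A := {ξ | ‖Z ξ - g‖ ≤ s})
      (B := fun g' => {ξ | ‖Z ξ - g'‖ ≤ s / 8}) hSne (fun ξ hξ => hScov _ (hZK ξ) hξ)
    refine ⟨g', hSK _ hg'S, ?_⟩
    rw [show s / 4 = s / 8 + s / 8 by ring]
    refine integral_norm_sub_le_of_lt_measure hn hμ hZ (by positivity) ?_
    have hhalf : ENNReal.ofReal (1 / 2) ≤ μ {ξ | ‖Z ξ - g‖ ≤ s} := by
      have hi := integrable_norm_sub hn hμ hZ g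
      have hm := mul_meas_ge_le_integral_of_nonneg (ae_of_all μ fun ξ => norm_nonneg (Z ξ - g)) hi s
      have hZc := continuous_of_sqrt_mul_norm_sub_le hn hZ
      have hmeas : MeasurableSet {ξ | ‖Z ξ - g‖ ≤ s} :=
        measurableSet_le (by fun_prop) (by fun_prop)
      have h1 : μ.real {ξ | ‖Z ξ - g‖ ≤ s}ᶜ ≤ 1 / 2 := by
        refine (measureReal_mono (fun ξ hξ => ?_)).trans
          (show μ.real {ξ | s ≤ ‖Z ξ - g‖} ≤ 1 / 2 from ?_)
        · exact (not_le.1 (show ¬ ‖Z ξ - g‖ ≤ s from hξ)).le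
        · nlinarith
      have h2 := probReal_add_probReal_compl (μ := μ) hmeas
      rw [← ofReal_measureReal]
      exact ENNReal.ofReal_le_ofReal (by linarith)
    have hcard0 : (0 : ℝ) < S.card := by exact_mod_cast Finset.card_pos.2 hSne
    have h1 : ENNReal.ofReal (1 / 2 / S.card) ≤ μ {ξ | ‖Z ξ - g'‖ ≤ s / 8} := by
      rw [ENNReal.ofReal_div_of_pos hcard0, ENNReal.ofReal_natCast]
      exact ENNReal.div_le_of_le_mul' (hhalf.trans hg')
    refine lt_of_lt_of_le ?_ h1
    rw [ENNReal.ofReal_lt_ofReal_iff (by positivity), lt_div_iff₀ hcard0]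
    have h8 : (8 : ℝ) < Real.exp 3 := by
      have := Real.exp_one_gt_d9
      rw [show (3 : ℝ) = 1 + 1 + 1 by norm_num, Real.exp_add, Real.exp_add]
      nlinarith [Real.exp_pos 1, mul_pos (Real.exp_pos 1) (Real.exp_pos 1)]
    -- As `s ≥ L r`, this makes the exponent at `t = s/8` at least `2 n r²`, hence at least `n r² +
    -- 3`; the spare `e³ > 8` covers the factors `2`, `2` and `1/2`.
    have hLsq : 128 ≤ cL * L ^ 2 := by
      have : cL * L = cL + 128 := by simp only [L]; field_simp
      nlinarith
    have hexp : n * r ^ 2 + 3 ≤ cL * (n * (s / 8) ^ 2) := by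
      have h2 : (L * r) ^ 2 ≤ s ^ 2 := pow_le_pow_left₀ (by positivity) hs 2
      have h3 : cL * n * (L * r) ^ 2 ≤ cL * n * s ^ 2 :=
        mul_le_mul_of_nonneg_left h2 (by positivity)
      have h4 : 128 * (n * r ^ 2) ≤ cL * L ^ 2 * (n * r ^ 2) :=
        mul_le_mul_of_nonneg_right hLsq (by positivity)
      nlinarith
    have h5 : Real.exp (n * r ^ 2) * Real.exp 3 * Real.exp (-(cL * (n * (s / 8) ^ 2))) ≤ 1 := by
      rw [← Real.exp_add, ← Real.exp_add, Real.exp_le_one_iff]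
      linarith
    set q := Real.exp (-(cL * (n * (s / 8) ^ 2)))
    set p := Real.exp (n * r ^ 2)
    have hq : 0 < q := Real.exp_pos _
    have hp : 0 < p := Real.exp_pos _
    have h6 : p * q * 8 < p * q * Real.exp 3 := mul_lt_mul_of_pos_left h8 (by positivity)
    have h7 : 2 * q * S.card ≤ 2 * q * (2 * p) := mul_le_mul_of_nonneg_left hScard (by positivity)
    nlinarith
  have hKne : Nonempty K := ⟨⟨Z 0, hZK 0⟩⟩
  have hbdd : BddBelow (Set.range fun g : K => ∫ ξ, ‖Z ξ - g‖ ∂μ) :=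
    ⟨0, by rintro _ ⟨g, rfl⟩; exact integral_nonneg fun ξ => norm_nonneg _⟩
  set e := ⨅ g : K, ∫ ξ, ‖Z ξ - g‖ ∂μ
  have he : L * r ≤ e := le_ciInf fun g => hfar g g.2
  have he0 : 0 < e := lt_of_lt_of_le (by positivity) he
  -- With `s = 3e`, a center below `3e/2` improves to one at most `3e/4`, less than the infimum `e`.
  obtain ⟨g, hg⟩ := exists_lt_of_ciInf_lt (show e < 3 / 2 * e by linarith)
  obtain ⟨g', hg', hle⟩ := hshrink (3 * e) (by linarith) g g.2 (by linarith)
  have := ciInf_le hbdd ⟨g', hg'⟩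
  simp only at this
  linarith

end Localization

/-! ### Least squares as a projection -/

section LeastSquares

variable {X : Type*} {n : ℕ} {x : Fin n → X} {F : Set (X → ℝ)} {fhat : Vec n → X → ℝ}
  {cL : ℝ} {μ : Measure (Vec n)}

theorem convex_empClass (hF : Convex ℝ F) : Convex ℝ (empClass x F) := by
  refine hF.is_linear_image ⟨fun f g => ?_, fun c f => ?_⟩
  · ext i; simp [empVec, add_div]
  · ext i; simp [empVec, mul_div_assoc]

theorem norm_empVec_sub_sq (f g : X → ℝ) :
    ‖empVec x f - empVec x g‖ ^ 2 = empMean x fun p => (f p - g p) ^ 2 := by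
  rw [← dist_eq_norm, dist_empVec_sq]

theorem empLoss_eq_norm_sq (Y : Vec n) (f : X → ℝ) :
    empLoss x Y f = ‖(√(n : ℝ))⁻¹ • Y - empVec x f‖ ^ 2 := by
  rw [EuclideanSpace.norm_sq_eq, empLoss, Finset.mul_sum]
  refine Finset.sum_congr rfl fun i _ => ?_
  simp only [empVec, PiLp.sub_apply, PiLp.smul_apply, smul_eq_mul, Real.norm_eq_abs, sq_abs]
  rw [inv_mul_eq_div, ← sub_div, div_pow, Real.sq_sqrt (Nat.cast_nonneg n)]
  ring

theorem sqrt_smul_empVec (hn : 1 ≤ n) (f : X → ℝ) (i : Fin n) :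
    √n * empVec x f i = f (x i) := by
  have : √(n : ℝ) ≠ 0 := (Real.sqrt_pos.2 (by exact_mod_cast hn)).ne'
  simp only [empVec]
  field_simp

theorem obs_eq (hn : 1 ≤ n) (f : X → ℝ) (ξ : Vec n) :
    obs x f ξ = √n • empVec x f + ξ := by
  ext i
  simp only [obs, PiLp.add_apply, PiLp.smul_apply, smul_eq_mul]
  rw [sqrt_smul_empVec hn]

/-- The least squares estimator projects the rescaled observations onto the class. -/
theorem IsLSE.norm_le (h : IsLSE x F fhat) (Y : Vec n) {k : Vec n} (hk : k ∈ empClass x F) :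
    ‖(√(n : ℝ))⁻¹ • Y - empVec x (fhat Y)‖ ≤ ‖(√(n : ℝ))⁻¹ • Y - k‖ := by
  obtain ⟨g, hg, rfl⟩ := hk
  have := (h Y).2 g hg
  rw [empLoss_eq_norm_sq, empLoss_eq_norm_sq] at this
  exact le_of_sq_le_sq this (norm_nonneg _)

theorem IsLSE.mem (h : IsLSE x F fhat) (Y : Vec n) : empVec x (fhat Y) ∈ empClass x F :=
  ⟨_, (h Y).1, rfl⟩

/-- The noise enters the projected point as `ξ/√n`; this is the hypothesis `hZ` of the concentration
results. -/
theorem IsLSE.sqrt_mul_norm_sub_le (hn : 1 ≤ n) (hF : Convex ℝ F) (h : IsLSE x F fhat)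
    (fstar : X → ℝ) (ξ ζ : Vec n) :
    √n * ‖empVec x (fhat (obs x fstar ξ)) - empVec x (fhat (obs x fstar ζ))‖ ≤ ‖ξ - ζ‖ := by
  have h0 : 0 < √(n : ℝ) := Real.sqrt_pos.2 (by exact_mod_cast hn)
  have h1 := norm_sub_le_of_nearest (convex_empClass hF) (h.mem (obs x fstar ξ))
    (h.mem (obs x fstar ζ)) (fun k hk => h.norm_le _ hk) (fun k hk => h.norm_le _ hk)
  have e : obs x fstar ξ - obs x fstar ζ = ξ - ζ := by
    rw [obs_eq hn, obs_eq hn, add_sub_add_left_eq_sub]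
  rw [← smul_sub, norm_smul, norm_inv, Real.norm_of_nonneg h0.le, e] at h1
  exact (le_inv_mul_iff₀ h0).1 h1

theorem norm_empVec_sub_le_of_mem_almostMinimizers (hF : Convex ℝ F) (h : IsLSE x F fhat)
    {Y : Vec n} {δ : ℝ} {f : X → ℝ} (hf : f ∈ almostMinimizers x F fhat Y δ) :
    ‖empVec x f - empVec x (fhat Y)‖ ^ 2 ≤ δ := by
  have h1 := norm_sub_sq_le_of_nearest (convex_empClass hF) (h.mem Y)
    (fun k hk => h.norm_le _ hk) (Set.mem_image_of_mem _ hf.1)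
  have h2 := hf.2
  rw [empLoss_eq_norm_sq, empLoss_eq_norm_sq] at h2
  linarith

theorem IsLSE.integrable (hn : 1 ≤ n) (hF : Convex ℝ F) (h : IsLSE x F fhat)
    (hμ : LipschitzConcentration cL μ) (fstar : X → ℝ) (i : Fin n) :
    Integrable (fun ξ => fhat (obs x fstar ξ) (x i)) μ := by
  have hi := integrable_of_sqrt_mul_norm_sub_le hn hμ (h.sqrt_mul_norm_sub_le hn hF fstar)
  have := ((EuclideanSpace.proj (𝕜 := ℝ) i).integrable_comp hi).const_mul (√(n : ℝ))
  refine this.congr (ae_of_all _ fun ξ => ?_)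
  exact sqrt_smul_empVec hn _ i

theorem IsLSE.empVec_expectedEst (hn : 1 ≤ n) (hF : Convex ℝ F) (h : IsLSE x F fhat)
    (hμ : LipschitzConcentration cL μ) (fstar : X → ℝ) :
    empVec x (expectedEst x μ fhat fstar) = ∫ ξ, empVec x (fhat (obs x fstar ξ)) ∂μ := by
  have hi := integrable_of_sqrt_mul_norm_sub_le hn hμ (h.sqrt_mul_norm_sub_le hn hF fstar)
  ext i
  have e := (EuclideanSpace.proj (𝕜 := ℝ) i).integral_comp_comm hi
  refine Eq.trans ?_ e
  exact (integral_div _ _).symm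

theorem IsLSE.variance_eq (hn : 1 ≤ n) (hF : Convex ℝ F) (h : IsLSE x F fhat)
    (hμ : LipschitzConcentration cL μ) (fstar : X → ℝ) :
    variance x μ fhat fstar = ∫⁻ ξ, ENNReal.ofReal (‖empVec x (fhat (obs x fstar ξ)) -
      ∫ ζ, empVec x (fhat (obs x fstar ζ)) ∂μ‖ ^ 2) ∂μ := by
  rw [variance, ← h.empVec_expectedEst hn hF hμ]
  simp_rw [norm_empVec_sub_sq]

/-- Positivity of `a` forces `log N > 0`, hence at least two centers. Then `log 2 ≤ b nε²`, so `1/n`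
is at most of order `ε²`. -/
theorem IsBalanced.exists_cover {a b ε : ℝ} (ha : 0 < a) (hn : 1 ≤ n)
    (hε : IsBalanced x F a b ε) :
    ∃ S : Finset (Vec n), 2 ≤ S.card ∧ Real.log S.card ≤ b * (n * ε ^ 2) ∧
      ∀ v ∈ empClass x F, ∃ g ∈ S, ‖v - g‖ ≤ ε := by
  obtain ⟨hε0, N, hN, hlow, hup⟩ := hε
  obtain ⟨C, -, hfin, hC, hcard⟩ :=
    Metric.exists_set_encard_eq_coveringNumber (by rw [hN]; exact ENat.natCast_ne_top N)
  have hcardN : hfin.toFinset.card = N := by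
    rw [hN, hfin.encard_eq_coe_toFinset_card] at hcard
    exact_mod_cast hcard
  refine ⟨hfin.toFinset, ?_, by rwa [hcardN], fun v hv => ?_⟩
  · rw [hcardN]
    have hn0 : (0 : ℝ) < n := by exact_mod_cast hn
    have h0 : 0 < Real.log N := lt_of_lt_of_le (by positivity) hlow
    by_contra! hlt
    interval_cases N <;> simp at h0
  · obtain ⟨g, hg, hvg⟩ := hC hv
    refine ⟨g, hfin.mem_toFinset.2 hg, ?_⟩
    have h1 : edist v g ≤ ε.toNNReal := hvg
    rwa [edist_dist, ENNReal.ofReal_le_coe, Real.coe_toNNReal _ hε0.le, dist_eq_norm] at h1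

theorem IsLSE.exists_center_of_isBalanced [IsProbabilityMeasure μ] (hn : 1 ≤ n) (hF : Convex ℝ F)
    (h : IsLSE x F fhat) (hcL : 0 < cL) (hμ : LipschitzConcentration cL μ) {a b ε : ℝ}
    (ha : 0 < a) (hb : 0 < b) (hε : IsBalanced x F a b ε) (fstar : X → ℝ) :
    ∃ g, ∫ ξ, ‖empVec x (fhat (obs x fstar ξ)) - g‖ ∂μ ≤ (1 + √((2 * b + 1) / cL)) * ε := by
  obtain ⟨S, hcard, hlog, hcov⟩ := hε.exists_cover ha hn
  exact exists_integral_norm_sub_le_of_cover hn hcL hμ (h.sqrt_mul_norm_sub_le hn hF fstar)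
    hb hε.1 (fun ξ => hcov _ (h.mem _)) hcard hlog

/-- With high probability, all almost minimizers are close to the expected estimator. -/
theorem IsLSE.measure_almostMinimizers_le [IsProbabilityMeasure μ] (hn : 1 ≤ n)
    (hF : Convex ℝ F) (h : IsLSE x F fhat) (hμ : LipschitzConcentration cL μ) {fstar : X → ℝ}
    {g : Vec n} {T ε K δ : ℝ} (hε : 0 < ε) (hK : 0 ≤ K) (hδ : δ ≤ K * ε ^ 2)
    (hg : ∫ ξ, ‖empVec x (fhat (obs x fstar ξ)) - g‖ ∂μ ≤ T * ε) :
    μ {ξ | ¬ ∀ f ∈ almostMinimizers x F fhat (obs x fstar ξ) δ,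
        empMean x (fun p => (f p - expectedEst x μ fhat fstar p) ^ 2)
          ≤ (√K + 1 + 2 * T) ^ 2 * ε ^ 2}
      ≤ ENNReal.ofReal (2 * Real.exp (-(cL * (n * ε ^ 2)))) := by
  have hZ := h.sqrt_mul_norm_sub_le hn hF fstar
  refine (measure_mono fun ξ hξ => ?_).trans (measure_deviation_norm_sub_le hn hμ hZ g hε.le)
  by_contra hdev
  refine hξ fun f hf => ?_
  have h1 : |‖empVec x (fhat (obs x fstar ξ)) - g‖ -
      ∫ ζ, ‖empVec x (fhat (obs x fstar ζ)) - g‖ ∂μ| < ε := not_le.1 hdev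
  have h2 := (abs_lt.1 h1).2
  have h3 : ‖empVec x f - empVec x (fhat (obs x fstar ξ))‖ ≤ √K * ε := by
    refine le_of_sq_le_sq ?_ (by positivity)
    rw [mul_pow, Real.sq_sqrt hK]
    exact (norm_empVec_sub_le_of_mem_almostMinimizers hF h hf).trans hδ
  have h4 := norm_integral_sub_le hn hμ hZ g
  rw [← norm_empVec_sub_sq, h.empVec_expectedEst hn hF hμ, ← mul_pow]
  refine pow_le_pow_left₀ (norm_nonneg _) ?_ 2
  -- The three distances are at most `√K ε`, `(T + 1) ε` and `T ε`.
  calc _ ≤ ‖empVec x f - empVec x (fhat (obs x fstar ξ))‖ +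
        (‖empVec x (fhat (obs x fstar ξ)) - g‖ +
          ‖g - ∫ ζ, empVec x (fhat (obs x fstar ζ)) ∂μ‖) :=
        (norm_sub_le_norm_sub_add_norm_sub _ _ _).trans
          (add_le_add_right (norm_sub_le_norm_sub_add_norm_sub _ _ _) _)
    _ ≤ _ := by nlinarith

theorem IsLSE.variance_le [IsProbabilityMeasure μ] (hn : 1 ≤ n) (hF : Convex ℝ F)
    (h : IsLSE x F fhat) (hcL : 0 < cL) (hμ : LipschitzConcentration cL μ) {fstar : X → ℝ}
    {g : Vec n} {m : ℝ} (hg : ∫ ξ, ‖empVec x (fhat (obs x fstar ξ)) - g‖ ∂μ ≤ m) :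
    variance x μ fhat fstar ≤ ENNReal.ofReal (8 * m ^ 2 + 4 / (cL * n)) := by
  rw [h.variance_eq hn hF hμ]
  exact lintegral_norm_sub_integral_sq_le hn hcL hμ (h.sqrt_mul_norm_sub_le hn hF fstar) hg

theorem IsLSE.maxVariance_le_of_isBalanced [IsProbabilityMeasure μ] (hn : 1 ≤ n)
    (hF : Convex ℝ F) (h : IsLSE x F fhat) (hcL : 0 < cL) (hμ : LipschitzConcentration cL μ)
    {a b ε : ℝ} (ha : 0 < a) (hb : 0 < b) (hε : IsBalanced x F a b ε) :
    maxVariance x μ F fhat ≤ ENNReal.ofReal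
      ((8 * (1 + √((2 * b + 1) / cL)) ^ 2 + 4 * b / (cL * Real.log 2)) * ε ^ 2) := by
  refine iSup₂_le fun fstar _ => ?_
  obtain ⟨g, hg⟩ := h.exists_center_of_isBalanced hn hF hcL hμ ha hb hε fstar
  refine (h.variance_le hn hF hcL hμ hg).trans (ENNReal.ofReal_le_ofReal ?_)
  obtain ⟨S, hcard, hlog, -⟩ := hε.exists_cover ha hn
  have hn0 : (0 : ℝ) < n := by exact_mod_cast hn
  have hl2 : 0 < Real.log 2 := Real.log_pos (by norm_num)
  have h1 : Real.log 2 ≤ b * (n * ε ^ 2) :=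
    (Real.log_le_log (by norm_num) (by exact_mod_cast hcard)).trans hlog
  have h2 : 4 / (cL * n) ≤ 4 * b / (cL * Real.log 2) * ε ^ 2 := by
    rw [div_mul_eq_mul_div, div_le_div_iff₀ (by positivity) (by positivity)]
    nlinarith [mul_le_mul_of_nonneg_left h1 hcL.le]
  rw [mul_pow]
  linarith

/-- Halving `d` avoids attainment of the diameter; the cap `1` meets the condition `κ ≤ 1` of
`inv_le_risk`. -/
theorem exists_le_norm_sub_of_hasDiamBetween {d D : ℝ} (hd : 0 < d)
    (h : HasDiamBetween x F d D) :
    ∃ v ∈ empClass x F, ∃ w ∈ empClass x F, min (d / 2) 1 ≤ ‖v - w‖ := by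
  by_contra! hlt
  have h1 : Metric.ediam (empClass x F) ≤ ENNReal.ofReal (d / 2) := by
    refine Metric.ediam_le fun v hv w hw => ?_
    rw [edist_dist, dist_eq_norm]
    exact ENNReal.ofReal_le_ofReal ((hlt v hv w hw).le.trans (min_le_left _ _))
  have h2 := (ENNReal.ofReal_le_ofReal_iff (by positivity)).1 (h.1.trans h1)
  linarith

/-- The variance of least squares is at most of the order of the risk of any estimator. -/
theorem IsLSE.maxVariance_le_risk [IsProbabilityMeasure μ] (hn : 1 ≤ n) (hF : Convex ℝ F)
    (h : IsLSE x F fhat) (hcL : 0 < cL) (hμ : LipschitzConcentration cL μ) {d D : ℝ} (hd : 0 < d)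
    (hdiam : HasDiamBetween x F d D) {est : Vec n → X → ℝ} (hest : Measurable est) {κ : ℝ}
    (hκ : κ = min (d / 2) 1) :
    maxVariance x μ F fhat ≤ ENNReal.ofReal
      (8 * (1 + 128 / cL) ^ 2 * (2048 + 96 / κ ^ 2) + 128 / (cL * κ ^ 2)) *
        risk x (stdGaussian (Vec n)) F est := by
  have hκ0 : 0 < κ := hκ ▸ lt_min (by positivity) one_pos
  have hκ1 : κ ≤ 1 := hκ ▸ min_le_right _ _
  have hn0 : (0 : ℝ) < n := by exact_mod_cast hn
  by_cases htop : risk x (stdGaussian (Vec n)) F est = ⊤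
  · rw [htop, ENNReal.mul_top (ENNReal.ofReal_pos.2 (by positivity)).ne']
    exact le_top
  set R := (risk x (stdGaussian (Vec n)) F est).toReal
  have hRrisk : risk x (stdGaussian (Vec n)) F est = ENNReal.ofReal R :=
    (ENNReal.ofReal_toReal htop).symm
  set W : Vec n → Vec n := fun Y => empVec x (est Y)
  have hW : Measurable W := by
    refine (WithLp.measurable_toLp 2 _).comp (measurable_pi_lambda _ fun i => ?_)
    exact ((measurable_pi_apply (x i)).comp hest).div_const _
  have hR : ∀ v ∈ empClass x F, ∫⁻ ξ, ENNReal.ofReal (‖v - W (√n • v + ξ)‖ ^ 2)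
      ∂(stdGaussian (Vec n)) ≤ ENNReal.ofReal R := by
    rintro _ ⟨f, hf, rfl⟩
    rw [← hRrisk]
    refine le_trans (le_of_eq (lintegral_congr fun ξ => ?_))
      (le_iSup₂ (f := fun fstar (_ : fstar ∈ F) => ∫⁻ ξ, ENNReal.ofReal
        (empMean x fun p => (fstar p - est (obs x fstar ξ) p) ^ 2) ∂(stdGaussian (Vec n))) f hf)
    rw [← obs_eq hn, norm_empVec_sub_sq]
  have hK := convex_empClass (x := x) hF
  obtain ⟨v, hv, w, hw, hvw⟩ := exists_le_norm_sub_of_hasDiamBetween hd hdiam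
  have hlow := inv_le_risk hn hK hW hR hκ0 hκ1 hv hw (hκ ▸ hvw)
  have hR0 : 0 < R := by
    have : 0 < κ ^ 2 / n := by positivity
    linarith
  -- The scale is `r² = A R`: `2048` serves the packing bound, and `96 / κ²` with `R ≥ κ² / (32 n)`
  -- gives `n r² ≥ 3`.
  set A := 2048 + 96 / κ ^ 2
  have hA : 2048 ≤ A := by simp only [A]; linarith [show 0 < 96 / κ ^ 2 by positivity]
  have hr2 : √(A * R) ^ 2 = A * R := Real.sq_sqrt (by positivity)
  have hnr : 3 ≤ n * √(A * R) ^ 2 := by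
    rw [hr2]
    rw [div_le_iff₀ hn0] at hlow
    have h1 : 96 / κ ^ 2 * κ ^ 2 ≤ 96 / κ ^ 2 * (32 * R * n) :=
      mul_le_mul_of_nonneg_left hlow (by positivity)
    rw [div_mul_cancel₀ _ (by positivity)] at h1
    have : 0 < n * (2048 * R) := by positivity
    simp only [A]
    nlinarith
  refine iSup₂_le fun fstar _ => ?_
  obtain ⟨g, -, hg⟩ := exists_integral_norm_sub_lt_of_risk hn hcL hμ
    (h.sqrt_mul_norm_sub_le hn hF fstar) (fun ξ => h.mem _) hK hW hR
    (Real.sqrt_pos.2 (by positivity : 0 < A * R))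
    (by rw [hr2]; exact mul_le_mul_of_nonneg_right hA hR0.le) hnr
  rw [hRrisk, ← ENNReal.ofReal_mul (by positivity)]
  refine (h.variance_le hn hF hcL hμ hg.le).trans (ENNReal.ofReal_le_ofReal ?_)
  rw [mul_pow, hr2]
  have h2 : 4 / (cL * n) ≤ 128 / (cL * κ ^ 2) * R := by
    rw [div_le_iff₀ hn0] at hlow
    rw [div_mul_eq_mul_div, div_le_div_iff₀ (by positivity) (by positivity)]
    nlinarith [mul_le_mul_of_nonneg_left hlow hcL.le]
  linarith

end LeastSquares

end FixedDesign

end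

/-! ### The main theorem -/

theorem theoremT (cL : ℝ) (hcL : 0 < cL) :
    ∃ c : ℝ, 0 < c ∧
      ∀ a b d D K : ℝ, 0 < a → 0 < b → 0 < d → 0 < D → 0 < K →
        ∃ C : ℝ, 0 < C ∧
          ∀ (n : ℕ), 1 ≤ n →
          ∀ (X : Type*) (x : Fin n → X) (F : Set (X → ℝ)),
            FixedDesign.IsConvexClosedClass x F →
            FixedDesign.HasDiamBetween x F d D →
          ∀ (μ : Measure (FixedDesign.Vec n)), IsProbabilityMeasure μ →
            (μ = stdGaussian (FixedDesign.Vec n) ∨ FixedDesign.LipschitzConcentration cL μ) →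
          ∀ (fhat : FixedDesign.Vec n → X → ℝ), FixedDesign.IsLSE x F fhat →
            (∀ fstar ∈ F, ∀ i,
              Integrable (fun ξ => fhat (FixedDesign.obs x fstar ξ) (x i)) μ) ∧
            (∀ ε : ℝ, FixedDesign.IsBalanced x F a b ε →
              (∀ fstar ∈ F, ∀ δ : ℝ, 0 ≤ δ → δ ≤ K * ε ^ 2 →
                μ {ξ | ¬ ∀ f ∈ FixedDesign.almostMinimizers x F fhat
                      (FixedDesign.obs x fstar ξ) δ,
                    FixedDesign.empMean x
                      (fun p => (f p - FixedDesign.expectedEst x μ fhat fstar p) ^ 2)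
                        ≤ C * ε ^ 2}
                  ≤ ENNReal.ofReal (2 * Real.exp (-c * (n * ε ^ 2)))) ∧
              FixedDesign.maxVariance x μ F fhat ≤ ENNReal.ofReal (C * ε ^ 2)) ∧
            FixedDesign.maxVariance x μ F fhat
              ≤ ENNReal.ofReal C * FixedDesign.minimaxRate x F := by
  -- One constant for both kinds of noise; `2/π²` is the Gaussian one.
  set c : ℝ := min cL (2 / Real.pi ^ 2)
  have hc : 0 < c := lt_min hcL (by positivity)
  refine ⟨c, hc, fun a b d D K ha hb hd _ hK => ?_⟩
  set T : ℝ := 1 + √((2 * b + 1) / c)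
  set κ : ℝ := min (d / 2) 1 with hκ
  have hκ0 : 0 < κ := lt_min (by positivity) one_pos
  have hl2 : 0 < Real.log 2 := Real.log_pos (by norm_num)
  set C₁ : ℝ := (√K + 1 + 2 * T) ^ 2
  set C₂ : ℝ := 8 * T ^ 2 + 4 * b / (c * Real.log 2)
  set C₃ : ℝ := 8 * (1 + 128 / c) ^ 2 * (2048 + 96 / κ ^ 2) + 128 / (c * κ ^ 2)
  have hC₁ : 0 ≤ C₁ := sq_nonneg _
  have hC₂ : 0 ≤ C₂ := by positivity
  have hC₃ : 0 < C₃ := by positivity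
  refine ⟨C₁ + C₂ + C₃, by positivity, fun n hn X x F hF hdiam μ hμ hnoise fhat hfhat => ?_⟩
  have hconc : FixedDesign.LipschitzConcentration c μ := by
    rcases hnoise with rfl | h
    · exact (FixedDesign.lipschitzConcentration_stdGaussian n).mono (min_le_right _ _)
    · exact h.mono (min_le_left _ _)
  refine ⟨fun fstar _ i => hfhat.integrable hn hF.1 hconc fstar i, fun ε hε => ⟨?_, ?_⟩, ?_⟩
  · intro fstar _ δ _ hδ
    obtain ⟨g, hg⟩ := hfhat.exists_center_of_isBalanced hn hF.1 hc hconc ha hb hε fstar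
    rw [neg_mul]
    refine le_trans ?_ (hfhat.measure_almostMinimizers_le hn hF.1 hconc hε.1 hK.le hδ hg)
    refine measure_mono (Set.compl_subset_compl.2 fun ξ hξ f hf => (hξ f hf).trans ?_)
    exact mul_le_mul_of_nonneg_right (by linarith) (sq_nonneg ε)
  · refine (hfhat.maxVariance_le_of_isBalanced hn hF.1 hc hconc ha hb hε).trans
      (ENNReal.ofReal_le_ofReal ?_)
    exact mul_le_mul_of_nonneg_right (by linarith) (sq_nonneg ε)
  · have h0 : ENNReal.ofReal (C₁ + C₂ + C₃) ≠ 0 := (ENNReal.ofReal_pos.2 (by positivity)).ne'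
    -- Dividing by the constant leaves the infimum alone on the right, so that each estimator can be
    -- treated separately.
    rw [← ENNReal.div_le_iff' h0 ENNReal.ofReal_ne_top]
    refine le_iInf₂ fun est hest => ?_
    rw [ENNReal.div_le_iff' h0 ENNReal.ofReal_ne_top]
    refine (hfhat.maxVariance_le_risk hn hF.1 hc hconc hd hdiam hest hκ).trans ?_
    exact mul_le_mul_left (ENNReal.ofReal_le_ofReal (by linarith)) _
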